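/- A cavity with one photon mode (annihilation and creation operators $b,b^*$ on the one-mode Fock space, $[b,b^*]=1$) is crossed by two-level atoms $k=1,2,\dots$ (annihilation operators $a_k$), the $k$-th atom being in the cavity for $t\in[(k-1)\tau,k\tau)$, where $\tau>0$. During that time the Hamiltonian is $$H_k=\epsilon\,b^*b+\sum_jE\,a_j^*a_j+\lambda\,(b^*+b)\otimes a_k^*a_k ,\qquad \epsilon>0,\ E,\lambda\in\mathbb R .$$ The initial state is $\rho_C\otimes\bigotimes_k\rho_k$, where all $\rho_k$ are the same atomic density matrix commuting with $a_k^*a_k$. Put $p=\mathrm{Tr}(a_k^*a_k\rho_k)$. Let $\rho_C$ be a gauge-invariant density operator of the cavity, i.e. $e^{i\alpha b^*b}\rho_Ce^{-i\alpha b^*b}=\rho_C$ for all real $\alpha$. Let $\rho_C(n\tau)$ be the partial trace over the atoms of the state $$e^{-i\tau H_n}\cdots e^{-i\tau H_1}\Big(\rho_C\otimes\bigotimes_{k=1}^n\rho_k\Big)e^{i\tau H_1}\cdots e^{i\tau H_n}$$ of the cavity and the first $n$ atoms, and let $N(n\tau)=\mathrm{Tr}(b^*b\,\rho_C(n\tau))\in[0,\infty]$.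 Then $\rho_C(n\tau)=\mathcal L^n(\rho_C)$ for every $n\ge0$, where $\mathcal L(\rho)=\mathrm{Tr}_{A_1}[e^{-i\tau H_1}(\rho\otimes\rho_1)e^{i\tau H_1}]$ is the one-step map for the cavity and one atom; in particular $N(0)=\mathrm{Tr}(b^*b\,\rho_C)$. For every $n\ge 0$, $$N(n\tau)=N(0)+n\,p(1-p)\,\frac{2\lambda^2}{\epsilon^2}(1-\cos\epsilon\tau)+p^2\,\frac{2\lambda^2}{\epsilon^2}(1-\cos n\epsilon\tau).$$ Suppose moreover that $N(0)<\infty$, $\lambda\ne0$ and $\epsilon\tau\notin2\pi\mathbb Z$. Then $N(n\tau)<\infty$ for all $n$, and the following are equivalent: (i) $0<p<1$; (ii) $N(n\tau)$ grows linearly, i.e. for some $c>0$ the sequence $N(n\tau)-cn$ is bounded; (iii) $N(n\tau)\to\infty$ as $n\to\infty$; (iv) $N(n\tau)$ is unbounded. -/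

import Mathlib

open scoped ENNReal InnerProductSpace ComplexOrder

noncomputable section

namespace PhotonCavity

/-! ### Square-summable sequences and operators on them -/

/-- The Hilbert space `ℓ²(ι)` with complex coefficients. -/
abbrev L2 (ι : Type) : Type := lp (fun _ : ι => ℂ) 2

/-- Bounded operators on `ℓ²(ι)`. -/
abbrev Op (ι : Type) : Type := L2 ι →L[ℂ] L2 ι

/-- The possibly unbounded operator on `ℓ²(ι)` that acts on coordinates by `A`, on its maximal
domain `{ψ ∈ ℓ²(ι) : A ψ ∈ ℓ²(ι)}`. -/
def maxOp {ι : Type} (A : (ι → ℂ) →ₗ[ℂ] (ι → ℂ)) : L2 ι →ₗ.[ℂ] L2 ι where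
  domain :=
    { carrier := {ψ | Memℓp (A (ψ : ι → ℂ)) 2}
      add_mem' := by
        intro x y hx hy
        have h := Memℓp.add hx hy
        rwa [← map_add A] at h
      zero_mem' := by
        have h : Memℓp (0 : ι → ℂ) 2 := zero_memℓp
        rwa [← map_zero A] at h
      smul_mem' := by
        intro c x hx
        have h := Memℓp.const_smul hx c
        rwa [← map_smul A] at h }
  toFun :=
    { toFun := fun ψ => ⟨A (ψ.1 : ι → ℂ), ψ.2⟩
      map_add' := by
        intro x y
        ext i
        exact congrFun (map_add A (x.1 : ι → ℂ) (y.1 : ι → ℂ)) i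
      map_smul' := by
        intro c x
        ext i
        exact congrFun (map_smul A c (x.1 : ι → ℂ)) i }

/-- `U` is the strongly continuous one-parameter unitary group `t ↦ e^{-itH}`: the vectors at which
it is strongly differentiable at `0` are exactly those in the domain of `H`, and the derivative
there is `-iHψ`. -/
structure IsUnitaryGroup {E : Type} [NormedAddCommGroup E] [InnerProductSpace ℂ E]
    [CompleteSpace E] (H : E →ₗ.[ℂ] E) (U : ℝ → E →L[ℂ] E) : Prop where
  unitary : ∀ t, U t ∈ unitary (E →L[ℂ] E)
  zero : U 0 = 1
  add : ∀ s t, U (s + t) = U s * U t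
  continuous : ∀ ψ, Continuous fun t => U t ψ
  generator : ∀ ψ φ, (ψ, φ) ∈ H.graph ↔ HasDerivAt (fun t => U t ψ) (-Complex.I • φ) 0

open Classical in
/-- The propagator `e^{-itH}`. -/
def propagator {E : Type} [NormedAddCommGroup E] [InnerProductSpace ℂ E]
    [CompleteSpace E] (H : E →ₗ.[ℂ] E) (t : ℝ) : E →L[ℂ] E :=
  if h : ∃ U : ℝ → E →L[ℂ] E, IsUnitaryGroup H U then h.choose t else 0

/-! ### The cavity: one boson mode -/

/-- The Fock space of one boson mode, `ψ m` being the amplitude of `m` photons. -/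
abbrev Cavity : Type := L2 ℕ

/-- The vector with exactly `m` photons. -/
def numberState (m : ℕ) : Cavity := lp.single 2 m 1

/-- The annihilation operator `b` in coordinates: `b e_m = √m e_{m-1}`. -/
def annihilate : (ℕ → ℂ) →ₗ[ℂ] (ℕ → ℂ) where
  toFun f m := (Real.sqrt (m + 1) : ℂ) * f (m + 1)
  map_add' f g := by ext m; simp [mul_add]
  map_smul' c f := by ext m; simp [mul_left_comm]

/-- The creation operator `b*` in coordinates: `b* e_m = √(m+1) e_{m+1}`. -/
def create : (ℕ → ℂ) →ₗ[ℂ] (ℕ → ℂ) where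
  toFun f m := (Real.sqrt m : ℂ) * f (m - 1)
  map_add' f g := by ext m; simp [mul_add]
  map_smul' c f := by ext m; simp [mul_left_comm]

/-- The photon number operator `b*b`. -/
def numberOp : Cavity →ₗ.[ℂ] Cavity := maxOp (create ∘ₗ annihilate)

lemma create_annihilate_apply (f : ℕ → ℂ) (m : ℕ) : create (annihilate f) m = m * f m := by
  rcases m with _ | m
  · simp [create]
  · have h : ((Real.sqrt ((m : ℝ) + 1) : ℂ)) * (Real.sqrt ((m : ℝ) + 1) : ℂ) = (m : ℂ) + 1 := by
      rw [← Complex.ofReal_mul, Real.mul_self_sqrt (by positivity)]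
      simp
    simp only [create, annihilate, LinearMap.coe_mk, AddHom.coe_mk, Nat.add_sub_cancel]
    push_cast
    rw [← mul_assoc, h]

/-- `e_m` is an eigenvector of `b*b` with eigenvalue `m`. -/
lemma numberState_mem_graph (m : ℕ) :
    (numberState m, (m : ℂ) • numberState m) ∈ numberOp.graph := by
  have key : create (annihilate (numberState m : ℕ → ℂ))
      = (((m : ℂ) • numberState m : Cavity) : ℕ → ℂ) := by
    ext k
    rw [create_annihilate_apply, lp.coeFn_smul, Pi.smul_apply, smul_eq_mul]
    by_cases h : k = m
    · rw [h]
    · simp [numberState, h]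
  rw [LinearPMap.mem_graph_iff]
  refine ⟨⟨numberState m, ?_⟩, rfl, ?_⟩
  · change Memℓp (create (annihilate (numberState m : ℕ → ℂ))) 2
    rw [key]
    exact lp.memℓp _
  · ext k
    exact congrFun key k

/-- Density operators of the cavity: positive operators of trace one. -/
structure IsDensityOp (ρ : Op ℕ) : Prop where
  pos : ρ.IsPositive
  trace_one : HasSum (fun m : ℕ => ⟪numberState m, ρ (numberState m)⟫_ℂ) 1

/-- Gauge invariance `e^{iαN} ρ e^{-iαN} = ρ` for all real `α`, where `N = b*b`. -/
def IsGaugeInvariant (ρ : Op ℕ) : Prop :=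
  ∀ α : ℝ, propagator numberOp (-α) * ρ * propagator numberOp α = ρ

/-- The mean photon number `Tr(b*b ρ) ∈ [0, ∞]` of a positive operator `ρ`, computed in the
eigenbasis `b*b e_m = m e_m`. -/
def photonNumber (ρ : Op ℕ) : ℝ≥0∞ :=
  ∑' m : ℕ, ENNReal.ofReal ((m : ℝ) * (⟪numberState m, ρ (numberState m)⟫_ℂ).re)

/-! ### The atoms -/

/-- The annihilation operator `a` of a two-level atom (`true` is the excited state). -/
def lowering : Matrix Bool Bool ℂ := Matrix.single false true 1

/-- Gauge-invariant density matrices of a single atom: `[r, a*a] = 0`. -/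
structure IsAtomState (r : Matrix Bool Bool ℂ) : Prop where
  pos : r.PosSemidef
  trace_one : r.trace = 1
  gauge : Commute r (lowering.conjTranspose * lowering)

/-- The probability `Tr(a*a r)` that the atom is excited. -/
def excitation (r : Matrix Bool Bool ℂ) : ℝ :=
  ((lowering.conjTranspose * lowering * r).trace).re

/-! ### The cavity together with the first `n` atoms of the beam -/

/-- Basis labels of the joint system: photon number and levels of the `n` atoms. -/
abbrev Label (n : ℕ) : Type := ℕ × (Fin n → Bool)

/-- `A ⊗ 1` in coordinates. -/
def onCavity {n : ℕ} (A : (ℕ → ℂ) →ₗ[ℂ] (ℕ → ℂ)) : (Label n → ℂ) →ₗ[ℂ] (Label n → ℂ) where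
  toFun f x := A (fun m => f (m, x.2)) x.1
  map_add' f g := by
    ext x
    exact congrFun (map_add A (fun m => f (m, x.2)) (fun m => g (m, x.2))) x.1
  map_smul' c f := by
    ext x
    exact congrFun (map_smul A c (fun m => f (m, x.2))) x.1

/-- `1 ⊗ A_k` in coordinates, the matrix `A` acting on the `k`-th atom. -/
def onAtom {n : ℕ} (k : Fin n) (A : Matrix Bool Bool ℂ) :
    (Label n → ℂ) →ₗ[ℂ] (Label n → ℂ) where
  toFun f x := ∑ j : Bool, A (x.2 k) j * f (x.1, Function.update x.2 k j)
  map_add' f g := by ext x; simp [mul_add]; ring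
  map_smul' c f := by ext x; simp; ring

/-- The Hamiltonian `ε b*b ⊗ 1 + ∑_j 1 ⊗ E a_j* a_j + λ (b* + b) ⊗ a_k* a_k` while the `k`-th atom
is in the cavity; the coupling constant `λ` is called `g`. -/
def hamiltonian (ε E g : ℝ) (n : ℕ) (k : Fin n) : L2 (Label n) →ₗ.[ℂ] L2 (Label n) :=
  (ε : ℂ) • maxOp (onCavity (create ∘ₗ annihilate))
    + (E : ℂ) • maxOp (∑ j, onAtom j lowering.conjTranspose ∘ₗ onAtom j lowering)
    + (g : ℂ) • maxOp (onCavity (create + annihilate)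
        ∘ₗ onAtom k lowering.conjTranspose ∘ₗ onAtom k lowering)

lemma memℓp_slice {n : ℕ} (s : Fin n → Bool) (ψ : L2 (Label n)) :
    Memℓp (fun m : ℕ => (ψ : Label n → ℂ) (m, s)) 2 := by
  have h := (memℓp_gen_iff (p := 2) (by simp)).1 (lp.memℓp ψ)
  refine (memℓp_gen_iff (p := 2) (by simp)).2 ?_
  exact h.comp_injective (Prod.mk_left_injective s)

/-- The operator `1 ⊗ ⟨s|`, which takes `ψ` to its component `ψ(·, s)` in the cavity space. -/
def slice {n : ℕ} (s : Fin n → Bool) : L2 (Label n) →L[ℂ] Cavity :=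
  LinearMap.mkContinuous
    { toFun := fun ψ => ⟨fun m => (ψ : Label n → ℂ) (m, s), memℓp_slice s ψ⟩
      map_add' := by intro x y; ext m; rfl
      map_smul' := by intro c x; ext m; rfl } 1 (by
    intro ψ
    rw [one_mul]
    refine lp.norm_le_of_tsum_le (p := 2) (by simp) (norm_nonneg _) ?_
    rw [lp.norm_rpow_eq_tsum (p := 2) (by simp) ψ]
    exact tsum_comp_le_tsum_of_inj (i := fun m : ℕ => ((m, s) : Label n))
      ((memℓp_gen_iff (p := 2) (by simp)).1 (lp.memℓp ψ))
      (fun _ => by positivity) (Prod.mk_left_injective s))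

/-- The product state `ρ ⊗ r ⊗ ⋯ ⊗ r`. -/
def productState (n : ℕ) (ρ : Op ℕ) (r : Matrix Bool Bool ℂ) : Op (Label n) :=
  ∑ s : Fin n → Bool, ∑ s' : Fin n → Bool,
    (∏ k, r (s k) (s' k)) •
      (ContinuousLinearMap.adjoint (slice s) ∘L ρ ∘L slice s')

/-- The partial trace over the `n` atoms. -/
def traceAtoms {n : ℕ} (T : Op (Label n)) : Op ℕ :=
  ∑ s : Fin n → Bool, slice s ∘L T ∘L ContinuousLinearMap.adjoint (slice s)

/-- The state at time `nτ` of the cavity with the first `n` atoms: starting from `ρ ⊗ r ⊗ ⋯ ⊗ r`,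
the maps `T ↦ e^{-iτH_k} T e^{iτH_k}` are applied for the first, the second, …, the `n`-th atom. -/
def jointState (ε E g τ : ℝ) (r : Matrix Bool Bool ℂ) (ρ : Op ℕ) (n : ℕ) : Op (Label n) :=
  Fin.foldl n
    (fun T k => propagator (hamiltonian ε E g n k) τ * T
      * propagator (hamiltonian ε E g n k) (-τ))
    (productState n ρ r)

/-- The cavity state at time `nτ`. -/
def cavityState (ε E g τ : ℝ) (r : Matrix Bool Bool ℂ) (ρ : Op ℕ) (n : ℕ) : Op ℕ :=
  traceAtoms (jointState ε E g τ r ρ n)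

/-- The one-step map `ρ ↦ Tr_A [e^{-iτH} (ρ ⊗ r) e^{iτH}]` for the cavity and a single atom. -/
def stepMap (ε E g τ : ℝ) (r : Matrix Bool Bool ℂ) (ρ : Op ℕ) : Op ℕ :=
  traceAtoms (propagator (hamiltonian ε E g 1 0) τ * productState 1 ρ r
    * propagator (hamiltonian ε E g 1 0) (-τ))

end PhotonCavity

end

open PhotonCavity

/-! While the `k`-th atom crosses the cavity, every atomic level is conserved. For atoms in levels
`s` the cavity is thus driven by `ε b*b + g (b* + b)` or by `ε b*b`, according to `s k`, plus the
constant `E` times the number of excited atoms. Completing the square with `β = g / ε` gives an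
oscillator displaced by `β`, whose propagator sends the exponential vector of `z` to a multiple of
the one of `e^{-iετ}(z + β) - β`.

The atomic state commutes with `a*a`, so it is diagonal, and the partial trace turns the evolution
into a classical mixture. One step applies the displaced propagator with probability `p` and the
free one with probability `1 - p`, independently for each atom; this is why the cavity state is an
iterate of a one-step map. After `n` steps the state is a mixture of `Z ρ Z*`, where `Z` is unitary
and moves exponential vectors by `z ↦ u^n z + α`, with `u = e^{-iετ}`. The random `α` obeys `α ↦ u α
+ β (u - 1)` or `α ↦ u α` (`exists_mixture`).

A gauge-invariant `ρ` is diagonal in the number basis. From `b Z = Z (u^n b + α)` each `Z` adds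
exactly `|α|²` photons (`photonNumber_displacement`). The gain is therefore the second moment of
`α`. Its mean is `p β (u^n - 1)`, and the recursion for the second moment produces a term linear in
`n`, with slope proportional to `p (1 - p)`, and a bounded oscillation. The growth criteria follow
from positivity of that slope.

The analytic work is to identify the abstract `propagator` with the explicit group.
`hasDerivAt_oscGroup_iff` determines the generator with its exact domain, and
`IsUnitaryGroup.unique` shows that a densely defined generator determines its group. Vectors are
handled through the entire functions `fockSeries`, on which `b*` is multiplication by `z` and `b` is
differentiation. -/

namespace PhotonCavity

noncomputable section
open scoped ComplexConjugate

/-! ### Power series of amplitude sequences -/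

/-- Sequences of at most exponential growth. -/
def ExpGrowth (f : ℕ → ℂ) : Prop := ∃ C R : ℝ, 1 ≤ R ∧ ∀ k, ‖f k‖ ≤ C * R ^ k

/-- The entire function `∑ f k z^k / √k!` of an amplitude sequence. -/
def fockSeries (f : ℕ → ℂ) (z : ℂ) : ℂ := ∑' k : ℕ, f k * (z ^ k / (Real.sqrt k.factorial : ℂ))

/-- The term is `((2x)^k / √k!) * 2^{-k}`, a product bounded by the sum of the two squares; these
give an exponential and a geometric series. -/
lemma summable_pow_div_sqrt_factorial (x : ℝ) (hx : 0 ≤ x) :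
    Summable fun k : ℕ => x ^ k / Real.sqrt k.factorial := by
  have h1 : Summable fun k : ℕ => (4 * x ^ 2) ^ k / (k.factorial : ℝ) :=
    Real.summable_pow_div_factorial _
  have h2 : Summable fun k : ℕ => (1 / 4 : ℝ) ^ k :=
    summable_geometric_of_lt_one (by norm_num) (by norm_num)
  refine Summable.of_nonneg_of_le (fun k => by positivity) (fun k => ?_) (h1.add h2)
  have hs : Real.sqrt k.factorial ^ 2 = k.factorial := Real.sq_sqrt (by positivity)
  have hpos : 0 < Real.sqrt k.factorial := Real.sqrt_pos.2 (by positivity)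
  have e1 : (4 * x ^ 2) ^ k / (k.factorial : ℝ) = ((2 * x) ^ k / Real.sqrt k.factorial) ^ 2 := by
    rw [div_pow, hs, ← pow_mul, mul_comm k 2, pow_mul]; congr 2; ring
  have e2 : (1 / 4 : ℝ) ^ k = ((1 / 2 : ℝ) ^ k) ^ 2 := by
    rw [← pow_mul, mul_comm k 2, pow_mul]; norm_num
  have e3 : x ^ k / Real.sqrt k.factorial
      = ((2 * x) ^ k / Real.sqrt k.factorial) * (1 / 2 : ℝ) ^ k := by
    rw [div_mul_eq_mul_div, ← mul_pow]; congr 2; ring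
  rw [e1, e2, e3]
  nlinarith [sq_nonneg ((2 * x) ^ k / Real.sqrt k.factorial - (1 / 2 : ℝ) ^ k),
    sq_nonneg ((2 * x) ^ k / Real.sqrt k.factorial), sq_nonneg ((1 / 2 : ℝ) ^ k)]

lemma ExpGrowth.coeff_nonneg {f : ℕ → ℂ} {C R : ℝ} (h : ∀ k, ‖f k‖ ≤ C * R ^ k) : 0 ≤ C := by
  simpa using (norm_nonneg _).trans (h 0)

lemma ExpGrowth.of_bounded {f : ℕ → ℂ} (C : ℝ) (h : ∀ k, ‖f k‖ ≤ C) : ExpGrowth f :=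
  ⟨C, 1, le_rfl, by simpa using h⟩

lemma expGrowth_coe (ψ : Cavity) : ExpGrowth (ψ : ℕ → ℂ) :=
  .of_bounded ‖ψ‖ fun k => lp.norm_apply_le_norm (by simp) ψ k

lemma ExpGrowth.add {f g : ℕ → ℂ} (hf : ExpGrowth f) (hg : ExpGrowth g) : ExpGrowth (f + g) := by
  obtain ⟨C, R, hR, h⟩ := hf
  obtain ⟨C', R', hR', h'⟩ := hg
  have hC := coeff_nonneg h
  have hC' := coeff_nonneg h'
  refine ⟨C + C', max R R', le_max_of_le_left hR, fun k => ?_⟩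
  calc ‖f k + g k‖ ≤ C * R ^ k + C' * R' ^ k := (norm_add_le _ _).trans (add_le_add (h k) (h' k))
    _ ≤ C * max R R' ^ k + C' * max R R' ^ k := by
      gcongr
      · exact le_max_left _ _
      · exact le_max_right _ _
    _ = _ := by ring

lemma ExpGrowth.smul {f : ℕ → ℂ} (hf : ExpGrowth f) (c : ℂ) : ExpGrowth (c • f) := by
  obtain ⟨C, R, hR, h⟩ := hf
  refine ⟨‖c‖ * C, R, hR, fun k => ?_⟩
  rw [Pi.smul_apply, norm_smul, mul_assoc]
  gcongr
  exact h k

lemma sqrt_le_two_pow (k : ℕ) : Real.sqrt k ≤ 2 ^ k := by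
  rw [Real.sqrt_le_left (by positivity), ← pow_mul]
  calc (k : ℝ) ≤ 2 ^ k := by exact_mod_cast Nat.lt_two_pow_self.le
    _ ≤ 2 ^ (k * 2) := pow_le_pow_right₀ (by norm_num) (by omega)

/-- Neither ladder operator preserves `ℓ²`, but exponential growth survives both. Products of them
can therefore be handled as power series without domain conditions. -/
lemma ExpGrowth.annihilate {f : ℕ → ℂ} (hf : ExpGrowth f) : ExpGrowth (annihilate f) := by
  obtain ⟨C, R, hR, h⟩ := hf
  have hC := coeff_nonneg h
  refine ⟨2 * C * R, 2 * R, by linarith, fun k => ?_⟩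
  have h2 := sqrt_le_two_pow (k + 1)
  push_cast at h2
  calc ‖PhotonCavity.annihilate f k‖ = Real.sqrt (k + 1) * ‖f (k + 1)‖ := by
        simp [PhotonCavity.annihilate, abs_of_nonneg (Real.sqrt_nonneg _)]
    _ ≤ 2 ^ (k + 1) * (C * R ^ (k + 1)) := by gcongr; exact h _
    _ = _ := by rw [mul_pow]; ring

lemma ExpGrowth.create {f : ℕ → ℂ} (hf : ExpGrowth f) : ExpGrowth (create f) := by
  obtain ⟨C, R, hR, h⟩ := hf
  have hC := coeff_nonneg h
  refine ⟨C, 2 * R, by linarith, fun k => ?_⟩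
  have h2 := sqrt_le_two_pow k
  calc ‖PhotonCavity.create f k‖ = Real.sqrt k * ‖f (k - 1)‖ := by
        simp [PhotonCavity.create, abs_of_nonneg (Real.sqrt_nonneg _)]
    _ ≤ 2 ^ k * (C * R ^ (k - 1)) := by gcongr; exact h _
    _ ≤ 2 ^ k * (C * R ^ k) := by gcongr; omega
    _ = _ := by rw [mul_pow]; ring

lemma ExpGrowth.exists_bound {f : ℕ → ℂ} (hf : ExpGrowth f) (r : ℝ) (hr : 0 ≤ r) :
    ∃ u : ℕ → ℝ, Summable u ∧ ∀ z : ℂ, ‖z‖ ≤ r → ∀ k : ℕ,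
      ‖f k * (z ^ k / (Real.sqrt k.factorial : ℂ))‖ ≤ u k := by
  obtain ⟨C, R, hR, h⟩ := hf
  have hC := coeff_nonneg h
  refine ⟨_, (summable_pow_div_sqrt_factorial (R * r) (by positivity)).mul_left C,
    fun z hz k => ?_⟩
  calc ‖f k * (z ^ k / (Real.sqrt k.factorial : ℂ))‖
      = ‖f k‖ * (‖z‖ ^ k / Real.sqrt k.factorial) := by
        simp [abs_of_nonneg (Real.sqrt_nonneg _)]
    _ ≤ (C * R ^ k) * (r ^ k / Real.sqrt k.factorial) := by gcongr; exact h k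
    _ = _ := by rw [mul_pow]; ring

lemma ExpGrowth.summable {f : ℕ → ℂ} (hf : ExpGrowth f) (z : ℂ) :
    Summable fun k : ℕ => f k * (z ^ k / (Real.sqrt k.factorial : ℂ)) := by
  obtain ⟨u, hu, h⟩ := hf.exists_bound ‖z‖ (norm_nonneg z)
  exact .of_norm_bounded hu (h z le_rfl)

lemma fockSeries_add {f g : ℕ → ℂ} (hf : ExpGrowth f) (hg : ExpGrowth g) (z : ℂ) :
    fockSeries (f + g) z = fockSeries f z + fockSeries g z := by
  simp only [fockSeries, ← (hf.summable z).tsum_add (hg.summable z), Pi.add_apply, add_mul]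

lemma fockSeries_smul (c : ℂ) (f : ℕ → ℂ) (z : ℂ) :
    fockSeries (c • f) z = c * fockSeries f z := by
  simp only [fockSeries, ← tsum_mul_left, Pi.smul_apply, smul_eq_mul, mul_assoc]

lemma sqrt_factorial_succ (k : ℕ) :
    (Real.sqrt (k + 1).factorial : ℂ) = Real.sqrt (k + 1) * Real.sqrt k.factorial := by
  rw [Nat.factorial_succ, ← Complex.ofReal_mul, ← Real.sqrt_mul (by positivity)]
  push_cast; rfl

lemma sqrt_succ_mul_self (k : ℕ) : (Real.sqrt (k + 1) : ℂ) * Real.sqrt (k + 1) = k + 1 := by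
  rw [← Complex.ofReal_mul, Real.mul_self_sqrt (by positivity)]; simp

lemma sqrt_succ_ne_zero (k : ℕ) : (Real.sqrt (k + 1) : ℂ) ≠ 0 := by
  exact_mod_cast (Real.sqrt_pos.2 (by positivity)).ne'

lemma sqrt_factorial_ne_zero (k : ℕ) : (Real.sqrt k.factorial : ℂ) ≠ 0 := by
  exact_mod_cast (Real.sqrt_pos.2 (by positivity)).ne'

lemma fockSeries_create {f : ℕ → ℂ} (hf : ExpGrowth f) (z : ℂ) :
    fockSeries (create f) z = z * fockSeries f z := by
  rw [fockSeries, (hf.create.summable z).tsum_eq_zero_add, fockSeries, ← tsum_mul_left]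
  have h0 : create f 0 = 0 := by simp [create]
  rw [h0, zero_mul, zero_add]
  refine tsum_congr fun k => ?_
  have h := sqrt_succ_ne_zero k
  have h' := sqrt_factorial_ne_zero k
  rw [sqrt_factorial_succ]
  simp only [create, LinearMap.coe_mk, AddHom.coe_mk, Nat.add_sub_cancel]
  push_cast
  field_simp
  ring

/-- Termwise differentiation, with a majorant on the ball of radius `‖z‖ + 1`. The constant term is
split off so that the derivative of the term with index `k + 1` is the term `k` of the annihilated
sequence. -/
lemma hasDerivAt_fockSeries {f : ℕ → ℂ} (hf : ExpGrowth f) (z : ℂ) :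
    HasDerivAt (fockSeries f) (fockSeries (annihilate f) z) z := by
  obtain ⟨u, hu, hb⟩ := hf.annihilate.exists_bound (‖z‖ + 1) (by positivity)
  set G : ℕ → ℂ → ℂ := fun k w =>
    f (k + 1) * (w ^ (k + 1) / (Real.sqrt (k + 1).factorial : ℂ)) with hG
  have key : HasDerivAt (fun w => ∑' k, G k w) (fockSeries (annihilate f) z) z := by
    refine hasDerivAt_tsum_of_isPreconnected hu (Metric.isOpen_ball (x := (0 : ℂ)) (ε := ‖z‖ + 1))
      (convex_ball _ _).isPreconnected (fun k w _ => ?_)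
      (fun k w hw => hb w (by simpa using (mem_ball_zero_iff.1 hw).le) k)
      (y₀ := z) (by simp) ((summable_nat_add_iff 1).2 (hf.summable z)) (by simp)
    have h := ((hasDerivAt_pow (k + 1) w).div_const
      (Real.sqrt (k + 1).factorial : ℂ)).const_mul (f (k + 1))
    refine h.congr_deriv ?_
    have h1 := sqrt_succ_ne_zero k
    have h2 := sqrt_factorial_ne_zero k
    rw [sqrt_factorial_succ]
    simp only [annihilate, LinearMap.coe_mk, AddHom.coe_mk, Nat.add_sub_cancel]
    push_cast
    rw [← sqrt_succ_mul_self k]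
    field_simp
  have e : fockSeries f = fun w => f 0 + ∑' k, G k w := by
    ext w
    rw [fockSeries, (hf.summable w).tsum_eq_zero_add]
    simp [hG]
  rw [e]
  exact key.const_add _

lemma fockSeries_zero (f : ℕ → ℂ) : fockSeries f 0 = f 0 := by
  rw [fockSeries, tsum_eq_single 0 (fun k hk => by simp [hk])]
  simp

/-- The value at `0` is the coefficient `f 0`, and differentiating shifts the coefficients down by
one with nonzero factors. -/
lemma eq_zero_of_fockSeries_eq_zero {f : ℕ → ℂ} (hf : ExpGrowth f) (h : ∀ z, fockSeries f z = 0) :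
    f = 0 := by
  have key : ∀ n, ∀ f : ℕ → ℂ, ExpGrowth f → (∀ z, fockSeries f z = 0) → f n = 0 := by
    intro n
    induction n with
    | zero => intro f _ h; rw [← fockSeries_zero f, h]
    | succ n ih =>
      intro f hf h
      have h1 := ih _ hf.annihilate fun z => by
        have h2 := hasDerivAt_fockSeries hf z
        rw [show fockSeries f = fun _ => 0 from funext h] at h2
        exact h2.unique (hasDerivAt_const z 0)
      exact (mul_eq_zero.1 h1).resolve_left (sqrt_succ_ne_zero n)
  exact funext fun n => key n f hf h

lemma fockSeries_injective {f g : ℕ → ℂ} (hf : ExpGrowth f) (hg : ExpGrowth g)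
    (h : ∀ z, fockSeries f z = fockSeries g z) : f = g := by
  have := eq_zero_of_fockSeries_eq_zero (hf.add (hg.smul (-1))) fun z => by
    rw [fockSeries_add hf (hg.smul _), fockSeries_smul, h]; ring
  simpa [← sub_eq_add_neg, sub_eq_zero] using this

/-! ### Exponential vectors -/

lemma memℓp_two_iff {ι : Type} {f : ι → ℂ} : Memℓp f 2 ↔ Summable fun i => ‖f i‖ ^ 2 := by
  rw [memℓp_gen_iff (by simp)]
  norm_num

lemma norm_sq_eq_tsum {ι : Type} (ψ : L2 ι) : ‖ψ‖ ^ 2 = ∑' i, ‖ψ i‖ ^ 2 := by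
  have := lp.norm_rpow_eq_tsum (p := 2) (by simp) ψ
  norm_num at this
  exact this

/-- The exponential vector with amplitudes `z^k / √k!`. -/
def expVec (z : ℂ) : Cavity :=
  ⟨fun k : ℕ => z ^ k / (Real.sqrt k.factorial : ℂ), by
    refine memℓp_two_iff.2 ((Real.summable_pow_div_factorial (‖z‖ ^ 2)).congr fun k => ?_)
    rw [norm_div, div_pow, norm_pow, ← pow_mul, ← pow_mul, mul_comm,
      Complex.norm_real, Real.norm_eq_abs, sq_abs, Real.sq_sqrt (by positivity)]⟩

lemma expVec_apply (z : ℂ) (k : ℕ) : expVec z k = z ^ k / (Real.sqrt k.factorial : ℂ) := rfl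

/-- Exponential vectors are the reproducing kernel: pairing with them evaluates the entire function.
Hence they separate vectors and span a dense subspace. -/
lemma inner_expVec (z : ℂ) (ψ : Cavity) : ⟪expVec z, ψ⟫_ℂ = fockSeries ψ (conj z) := by
  rw [lp.inner_eq_tsum, fockSeries]
  refine tsum_congr fun k => ?_
  simp [expVec_apply]

lemma fockSeries_expVec (z w : ℂ) : fockSeries (expVec z) w = Complex.exp (z * w) := by
  rw [fockSeries, Complex.exp_eq_exp_ℂ, ← (NormedSpace.expSeries_div_hasSum_exp (z * w)).tsum_eq]
  refine tsum_congr fun k => ?_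
  rw [expVec_apply, div_mul_div_comm, ← mul_pow, ← Complex.ofReal_mul,
    Real.mul_self_sqrt (by positivity)]
  simp

lemma inner_expVec_expVec (z w : ℂ) : ⟪expVec z, expVec w⟫_ℂ = Complex.exp (conj z * w) := by
  rw [inner_expVec, fockSeries_expVec, mul_comm]

lemma eq_of_inner_expVec {ψ φ : Cavity} (h : ∀ z, ⟪expVec z, ψ⟫_ℂ = ⟪expVec z, φ⟫_ℂ) : ψ = φ := by
  refine lp.ext (fockSeries_injective (expGrowth_coe ψ) (expGrowth_coe φ) fun z => ?_)
  simpa [inner_expVec] using h (conj z)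

lemma dense_span_expVec : Dense (Submodule.span ℂ (Set.range expVec) : Set Cavity) := by
  rw [Submodule.dense_iff_topologicalClosure_eq_top,
    Submodule.topologicalClosure_eq_top_iff, Submodule.eq_bot_iff]
  intro ψ hψ
  refine eq_of_inner_expVec fun z => ?_
  rw [inner_zero_right]
  exact (Submodule.mem_orthogonal _ _).1 hψ _ (Submodule.subset_span ⟨z, rfl⟩)

lemma ext_expVec {T S : Op ℕ} (h : ∀ z, T (expVec z) = S (expVec z)) : T = S :=
  ContinuousLinearMap.ext_on dense_span_expVec (by rintro _ ⟨z, rfl⟩; exact h z)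

lemma continuous_expVec : Continuous expVec := by
  rw [continuous_iff_continuousAt]
  intro w
  rw [ContinuousAt, tendsto_iff_norm_sub_tendsto_zero]
  have h : ∀ z, ‖expVec z - expVec w‖ = Real.sqrt ((Complex.exp (conj z * z)).re
      - 2 * (Complex.exp (conj z * w)).re + (Complex.exp (conj w * w)).re) := by
    intro z
    rw [← Real.sqrt_sq (norm_nonneg (expVec z - expVec w)), @norm_sub_sq ℂ,
      ← inner_self_eq_norm_sq (𝕜 := ℂ), ← inner_self_eq_norm_sq (𝕜 := ℂ)]
    simp only [inner_expVec_expVec]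
    rfl
  simp only [h]
  have hc : Continuous fun z : ℂ => Real.sqrt ((Complex.exp (conj z * z)).re
      - 2 * (Complex.exp (conj z * w)).re + (Complex.exp (conj w * w)).re) := by fun_prop
  have := hc.tendsto w
  convert this using 2
  ring_nf
  simp

/-! ### The unitary group of the displaced oscillator -/

/-- Norms of linear combinations depend only on the Gram matrix. Equal Gram matrices therefore make
`expVec z ↦ g z` well defined and isometric on the span. -/
lemma norm_linearCombination_eq {g : ℂ → Cavity}
    (hg : ∀ z w, ⟪g z, g w⟫_ℂ = ⟪expVec z, expVec w⟫_ℂ) (a : ℂ →₀ ℂ) :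
    ‖Finsupp.linearCombination ℂ g a‖ = ‖Finsupp.linearCombination ℂ expVec a‖ := by
  have h : ⟪Finsupp.linearCombination ℂ g a, Finsupp.linearCombination ℂ g a⟫_ℂ
      = ⟪Finsupp.linearCombination ℂ expVec a, Finsupp.linearCombination ℂ expVec a⟫_ℂ := by
    simp only [Finsupp.linearCombination_apply, Finsupp.sum, sum_inner, inner_sum, inner_smul_left,
      inner_smul_right, hg]
  rw [inner_self_eq_norm_sq_to_K, inner_self_eq_norm_sq_to_K] at h
  exact (sq_eq_sq₀ (norm_nonneg _) (norm_nonneg _)).1 (by exact_mod_cast h)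

lemma denseRange_linearCombination_expVec :
    DenseRange (Finsupp.linearCombination ℂ expVec) := by
  have h := dense_span_expVec
  rw [← Finsupp.range_linearCombination] at h
  exact h

/-- The operator that maps each exponential vector `expVec z` to `g z`. -/
def ofExpVec (g : ℂ → Cavity) : Op ℕ :=
  LinearMap.extendOfNorm (Finsupp.linearCombination ℂ g) (Finsupp.linearCombination ℂ expVec)

lemma ofExpVec_apply {g : ℂ → Cavity} (hg : ∀ z w, ⟪g z, g w⟫_ℂ = ⟪expVec z, expVec w⟫_ℂ) (z : ℂ) :
    ofExpVec g (expVec z) = g z := by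
  have := LinearMap.extendOfNorm_eq (f := Finsupp.linearCombination ℂ g)
    denseRange_linearCombination_expVec
    ⟨1, fun a => by rw [one_mul, norm_linearCombination_eq hg a]⟩ (Finsupp.single z 1)
  simpa [ofExpVec] using this

lemma norm_ofExpVec {g : ℂ → Cavity} (hg : ∀ z w, ⟪g z, g w⟫_ℂ = ⟪expVec z, expVec w⟫_ℂ)
    (ψ : Cavity) : ‖ofExpVec g ψ‖ = ‖ψ‖ := by
  refine denseRange_linearCombination_expVec.induction_on
    (p := fun ψ => ‖ofExpVec g ψ‖ = ‖ψ‖) ψ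
    (isClosed_eq (by fun_prop) (by fun_prop)) fun a => ?_
  rw [ofExpVec, LinearMap.extendOfNorm_eq denseRange_linearCombination_expVec
    ⟨1, fun a => by rw [one_mul, norm_linearCombination_eq hg a]⟩, norm_linearCombination_eq hg a]

/-- The phase `e^{-iεt}`. -/
def rot (ε t : ℝ) : ℂ := Complex.exp (-(Complex.I * ε * t))

lemma rot_zero (ε : ℝ) : rot ε 0 = 1 := by simp [rot]

lemma rot_add (ε s t : ℝ) : rot ε (s + t) = rot ε s * rot ε t := by
  rw [rot, rot, rot, ← Complex.exp_add]; push_cast; ring_nf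

lemma conj_rot (ε t : ℝ) : conj (rot ε t) = rot ε (-t) := by
  rw [rot, rot, ← Complex.exp_conj]; simp

lemma rot_neg_mul (ε t : ℝ) : rot ε (-t) * rot ε t = 1 := by
  rw [← rot_add]; simp [rot_zero]

lemma norm_rot (ε t : ℝ) : ‖rot ε t‖ = 1 := by
  rw [rot, show -(Complex.I * ε * t) = ((-(ε * t) : ℝ) : ℂ) * Complex.I by push_cast; ring]
  exact Complex.norm_exp_ofReal_mul_I _

lemma hasDerivAt_rot (ε t : ℝ) : HasDerivAt (rot ε) (-(Complex.I * ε) * rot ε t) t := by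
  have h1 : HasDerivAt (fun t : ℝ => (t : ℂ)) 1 t := Complex.ofRealCLM.hasDerivAt
  have h := ((h1.const_mul (Complex.I * ε)).neg).cexp
  refine h.congr_deriv ?_
  simp only [Pi.neg_apply, mul_one]
  rw [rot, mul_comm]

lemma continuous_rot (ε : ℝ) : Continuous (rot ε) :=
  continuous_iff_continuousAt.2 fun t => (hasDerivAt_rot ε t).continuousAt

/-- The classical flow `z ↦ e^{-iεt} (z + β) - β` of the displaced oscillator. -/
def oscFlow (ε β t : ℝ) (z : ℂ) : ℂ := rot ε t * (z + β) - β

/-- The exponent of the prefactor in the action on exponential vectors. -/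
def oscExponent (ε β t : ℝ) (z : ℂ) : ℂ :=
  Complex.I * ε * β ^ 2 * t + β * (rot ε t - 1) * (z + β)

/-- The phase `iεβ²t` is imaginary and drops out. What remains of the difference of the exponents is
a multiple of `rot ε (-t) * rot ε t - 1`, which vanishes. -/
lemma oscGroup_gram (ε β t : ℝ) (z w : ℂ) :
    ⟪Complex.exp (oscExponent ε β t z) • expVec (oscFlow ε β t z),
      Complex.exp (oscExponent ε β t w) • expVec (oscFlow ε β t w)⟫_ℂ
      = ⟪expVec z, expVec w⟫_ℂ := by
  rw [inner_smul_left, inner_smul_right, inner_expVec_expVec, inner_expVec_expVec,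
    ← Complex.exp_conj, ← Complex.exp_add, ← Complex.exp_add]
  congr 1
  have h := rot_neg_mul ε t
  simp only [oscExponent, oscFlow, map_add, map_mul, map_sub, map_pow, Complex.conj_I,
    Complex.conj_ofReal, conj_rot, map_one]
  linear_combination (conj z + β) * (w + β) * h

/-- The unitary group generated by `ε b*b + ε β (b* + b)`. -/
def oscGroup (ε β t : ℝ) : Op ℕ :=
  ofExpVec fun z => Complex.exp (oscExponent ε β t z) • expVec (oscFlow ε β t z)

lemma oscGroup_expVec (ε β t : ℝ) (z : ℂ) :
    oscGroup ε β t (expVec z) = Complex.exp (oscExponent ε β t z) • expVec (oscFlow ε β t z) :=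
  ofExpVec_apply (oscGroup_gram ε β t) z

lemma norm_oscGroup (ε β t : ℝ) (ψ : Cavity) : ‖oscGroup ε β t ψ‖ = ‖ψ‖ :=
  norm_ofExpVec (oscGroup_gram ε β t) ψ

lemma oscGroup_zero (ε β : ℝ) : oscGroup ε β 0 = 1 := by
  refine ext_expVec fun z => ?_
  simp [oscGroup_expVec, oscExponent, oscFlow, rot_zero]

lemma oscGroup_add (ε β s t : ℝ) :
    oscGroup ε β (s + t) = oscGroup ε β s * oscGroup ε β t := by
  refine ext_expVec fun z => ?_
  rw [mul_apply_eq_comp, oscGroup_expVec, oscGroup_expVec, map_smul, oscGroup_expVec,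
    smul_smul, ← Complex.exp_add]
  congr 2
  · simp only [oscExponent, oscFlow, rot_add]; push_cast; ring
  · simp only [oscFlow, rot_add]; ring

lemma oscGroup_mul_neg (ε β t : ℝ) : oscGroup ε β t * oscGroup ε β (-t) = 1 := by
  rw [← oscGroup_add, add_neg_cancel, oscGroup_zero]

lemma star_oscGroup (ε β t : ℝ) : star (oscGroup ε β t) = oscGroup ε β (-t) := by
  have h : star (oscGroup ε β t) * oscGroup ε β t = 1 :=
    (ContinuousLinearMap.norm_map_iff_adjoint_comp_self _).1 (norm_oscGroup ε β t)
  calc star (oscGroup ε β t)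
      = star (oscGroup ε β t) * (oscGroup ε β t * oscGroup ε β (-t)) := by
        rw [oscGroup_mul_neg, mul_one]
    _ = oscGroup ε β (-t) := by rw [← mul_assoc, h, one_mul]

lemma oscGroup_mem_unitary (ε β t : ℝ) : oscGroup ε β t ∈ unitary (Op ℕ) := by
  rw [Unitary.mem_iff, star_oscGroup]
  have := oscGroup_mul_neg ε β (-t)
  rw [neg_neg] at this
  exact ⟨this, oscGroup_mul_neg ε β t⟩

lemma inner_oscGroup (ε β t : ℝ) (ψ φ : Cavity) :
    ⟪ψ, oscGroup ε β t φ⟫_ℂ = ⟪oscGroup ε β (-t) ψ, φ⟫_ℂ := by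
  rw [← star_oscGroup, ContinuousLinearMap.star_eq_adjoint,
    ContinuousLinearMap.adjoint_inner_left]

/-- Moving the operator onto the kernel vector replaces `t` by `-t`, and conjugation restores `t`.
On entire functions the group thus acts by weighted composition with the flow. -/
lemma fockSeries_oscGroup (ε β t : ℝ) (ψ : Cavity) (z : ℂ) :
    fockSeries (oscGroup ε β t ψ) z
      = Complex.exp (oscExponent ε β t z) * fockSeries ψ (oscFlow ε β t z) := by
  have h := inner_oscGroup ε β t (expVec (conj z)) ψ
  rw [oscGroup_expVec, inner_smul_left, inner_expVec, inner_expVec, Complex.conj_conj,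
    ← Complex.exp_conj] at h
  rw [h]
  congr 2
  · simp [oscExponent, conj_rot]
  · simp [oscFlow, conj_rot]

lemma continuous_oscFlow (ε β : ℝ) (z : ℂ) : Continuous fun t => oscFlow ε β t z := by
  have := continuous_rot ε
  unfold oscFlow
  fun_prop

lemma continuous_oscExponent (ε β : ℝ) (z : ℂ) : Continuous fun t => oscExponent ε β t z := by
  have := continuous_rot ε
  unfold oscExponent
  fun_prop

lemma continuous_oscGroup (ε β : ℝ) (ψ : Cavity) : Continuous fun t => oscGroup ε β t ψ := by
  have hspan : ∀ φ ∈ Submodule.span ℂ (Set.range expVec),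
      Continuous fun t => oscGroup ε β t φ := by
    intro φ hφ
    induction hφ using Submodule.span_induction with
    | mem x hx =>
      obtain ⟨z, rfl⟩ := hx
      simp only [oscGroup_expVec]
      exact (Complex.continuous_exp.comp (continuous_oscExponent ε β z)).smul
        (continuous_expVec.comp (continuous_oscFlow ε β z))
    | zero => simpa using continuous_const
    | add x y _ _ hx hy => simp only [map_add]; exact hx.add hy
    | smul a x _ hx => simp only [map_smul]; exact hx.const_smul a
  -- Since each operator is isometric, approximating `ψ` from the span approximates its orbit
  -- uniformly in time.
  refine continuous_of_uniform_approx_of_continuous fun u hu => ?_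
  obtain ⟨δ, hδ, hu⟩ := Metric.mem_uniformity_dist.1 hu
  obtain ⟨φ, hφ, hd⟩ := Metric.mem_closure_iff.1 (dense_span_expVec ψ) δ hδ
  refine ⟨_, hspan φ hφ, fun t => hu ?_⟩
  rwa [dist_eq_norm, ← map_sub, norm_oscGroup, ← dist_eq_norm]

/-! ### Its generator -/

/-- `ε b*b + g (b* + b)` in coordinates. -/
def oscHam (ε g : ℝ) : (ℕ → ℂ) →ₗ[ℂ] (ℕ → ℂ) :=
  (ε : ℂ) • (create ∘ₗ annihilate) + (g : ℂ) • (create + annihilate)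

lemma fockSeries_oscHam (ε g : ℝ) {f : ℕ → ℂ} (hf : ExpGrowth f) (z : ℂ) :
    fockSeries (oscHam ε g f) z
      = ε * (z * fockSeries (annihilate f) z)
        + g * (z * fockSeries f z + fockSeries (annihilate f) z) := by
  have h1 := hf.annihilate
  have h2 := hf.create
  have h3 := h1.create
  have : oscHam ε g f = (ε : ℂ) • create (annihilate f)
    + (g : ℂ) • (create f + annihilate f) := rfl
  rw [this, fockSeries_add (h3.smul _) ((h2.add h1).smul _), fockSeries_smul, fockSeries_smul,
    fockSeries_add h2 h1, fockSeries_create h1, fockSeries_create hf]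

/-- This is the weak Schrödinger equation at every time, from the chain rule. The two sides match
because `rot ε t * (z + β)` equals the flowed point plus `β`. -/
lemma hasDerivAt_fockSeries_oscGroup (ε β g : ℝ) (hg : g = ε * β) {ψ φ : Cavity}
    (h : oscHam ε g ψ = φ) (z : ℂ) (t : ℝ) :
    HasDerivAt (fun t => fockSeries (oscGroup ε β t ψ) z)
      (-Complex.I * fockSeries (oscGroup ε β t φ) z) t := by
  have hc : HasDerivAt (fun t : ℝ => (t : ℂ)) 1 t := Complex.ofRealCLM.hasDerivAt
  have hr := hasDerivAt_rot ε t
  have h1 : HasDerivAt (fun t => oscFlow ε β t z) _ t := (hr.mul_const (z + β)).sub_const _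
  have h2 : HasDerivAt (fun t => oscExponent ε β t z) _ t :=
    (hc.const_mul (Complex.I * ε * β ^ 2)).add (((hr.sub_const 1).const_mul (β : ℂ)).mul_const
      (z + β))
  have h3 := (hasDerivAt_fockSeries (expGrowth_coe ψ) (oscFlow ε β t z)).comp t h1
  have h4 := h2.cexp.mul h3
  simp only [fockSeries_oscGroup]
  refine h4.congr_deriv ?_
  rw [← h, fockSeries_oscHam ε g (expGrowth_coe ψ), hg]
  simp only [Function.comp_apply]
  generalize hA : oscExponent ε β t z = A
  generalize hZ : oscFlow ε β t z = Z
  have hu : rot ε t * (z + β) = Z + β := by rw [← hZ, oscFlow]; ring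
  generalize fockSeries ψ Z = F
  generalize fockSeries (annihilate ψ) Z = F'
  push_cast
  linear_combination (-Complex.I * ε * Complex.exp A * (β * F + F')) * hu

/-! ### A generator determines its unitary group -/

section Uniqueness

variable {E : Type} [NormedAddCommGroup E] [InnerProductSpace ℂ E]

/-- The norm along the orbit is constant, so its squared derivative at `0` vanishes: generators of
isometric groups are skew. -/
lemma inner_add_inner_eq_zero_of_hasDerivAt {U : ℝ → E →L[ℂ] E} (hn : ∀ t ψ, ‖U t ψ‖ = ‖ψ‖)
    (h0 : U 0 = 1) {η ξ : E} (h : HasDerivAt (fun t => U t η) ξ 0) :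
    ⟪η, ξ⟫_ℂ + ⟪ξ, η⟫_ℂ = 0 := by
  have h1 := h.inner ℂ h
  have h2 : (fun t => ⟪U t η, U t η⟫_ℂ) = fun _ => ⟪η, η⟫_ℂ := by
    ext t
    rw [inner_self_eq_norm_sq_to_K, inner_self_eq_norm_sq_to_K, hn]
  rw [h2, h0] at h1
  exact h1.unique (hasDerivAt_const _ _)

variable [CompleteSpace E] {H : E →ₗ.[ℂ] E} {U V : ℝ → E →L[ℂ] E}

lemma IsUnitaryGroup.norm_map (hU : IsUnitaryGroup H U) (t : ℝ) (ψ : E) : ‖U t ψ‖ = ‖ψ‖ :=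
  ContinuousLinearMap.norm_map_of_mem_unitary (hU.unitary t) ψ

lemma IsUnitaryGroup.map_graph (hU : IsUnitaryGroup H U) {ψ φ : E} (h : (ψ, φ) ∈ H.graph) (t : ℝ) :
    (U t ψ, U t φ) ∈ H.graph := by
  rw [hU.generator] at h ⊢
  have h1 := (U t).restrictScalars ℝ |>.hasFDerivAt.comp_hasDerivAt (0 : ℝ) h
  have e : (fun s => U s (U t ψ)) = fun s => U t (U s ψ) := by
    ext s
    rw [← mul_apply_eq_comp, ← mul_apply_eq_comp, ← hU.add, ← hU.add, add_comm]
  rw [e, ← map_smul]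
  exact h1

lemma IsUnitaryGroup.hasDerivAt (hU : IsUnitaryGroup H U) {ψ φ : E} (h : (ψ, φ) ∈ H.graph)
    (t : ℝ) : HasDerivAt (fun s => U s ψ) (-Complex.I • U t φ) t := by
  have h1 := (hU.generator _ _).1 (hU.map_graph h t)
  have h2 : HasDerivAt (fun s : ℝ => s - t) 1 t := (hasDerivAt_id t).sub_const t
  rw [← sub_self t] at h1
  have h3 := HasDerivAt.scomp (h := fun s => s - t) t h1 h2
  rw [one_smul] at h3
  refine h3.congr_of_eventuallyEq (Filter.Eventually.of_forall fun s => ?_)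
  simp only [Function.comp_apply]
  rw [← mul_apply_eq_comp, ← hU.add, sub_add_cancel]

/-- The difference of two orbits from the same domain vector stays in the domain. Skewness of the
generator makes its squared norm constant, and it starts at zero. -/
lemma IsUnitaryGroup.unique (hU : IsUnitaryGroup H U) (hV : IsUnitaryGroup H V)
    (hd : Dense (H.domain : Set E)) : U = V := by
  ext1 t
  rw [← Submodule.span_eq H.domain] at hd
  refine ContinuousLinearMap.ext_on hd fun ψ hψ' => ?_
  have hψ : (ψ, H ⟨ψ, hψ'⟩) ∈ H.graph := H.mem_graph ⟨ψ, hψ'⟩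
  set φ := H ⟨ψ, hψ'⟩
  have hder : ∀ s, HasDerivAt (fun s => ⟪U s ψ - V s ψ, U s ψ - V s ψ⟫_ℂ) 0 s := by
    intro s
    have h1 := (hU.hasDerivAt hψ s).sub (hV.hasDerivAt hψ s)
    have h2 := h1.inner ℂ h1
    have h3 := H.graph.sub_mem (hU.map_graph hψ s) (hV.map_graph hψ s)
    have h4 := inner_add_inner_eq_zero_of_hasDerivAt hU.norm_map hU.zero
      ((hU.generator _ _).1 h3)
    refine h2.congr_deriv ?_
    rw [← smul_sub]
    exact h4
  have hconst := is_const_of_deriv_eq_zero (fun s => (hder s).differentiableAt)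
    (fun s => (hder s).deriv) t 0
  simp only [hU.zero, hV.zero, sub_self, inner_zero_left] at hconst
  exact sub_eq_zero.1 (inner_self_eq_zero.1 hconst)

lemma IsUnitaryGroup.propagator_eq (hU : IsUnitaryGroup H U) (hd : Dense (H.domain : Set E))
    (t : ℝ) : propagator H t = U t := by
  have h : ∃ U, IsUnitaryGroup H U := ⟨U, hU⟩
  rw [propagator, dif_pos h, h.choose_spec.unique hU hd]

end Uniqueness

/-! ### The generator of the displaced oscillator -/

/-- Injectivity is asked only where the weight is nonzero. This admits the truncated shift `m ↦ m -
1`, which identifies `0` and `1`, with weight `√m`. -/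
lemma exists_weightedShift (w : ℕ → ℂ) (σ : ℕ → ℕ) (C : ℝ) (hw : ∀ m, ‖w m‖ ≤ C)
    (hσ : Set.InjOn σ (Function.support w)) :
    ∃ T : Op ℕ, ‖T‖ ≤ C ∧ ∀ ψ m, T ψ m = w m * ψ (σ m) := by
  have hC : 0 ≤ C := (norm_nonneg _).trans (hw 0)
  have key : ∀ (ψ : Cavity) (s : Finset ℕ),
      ∑ m ∈ s, ‖w m * ψ (σ m)‖ ^ (2 : ℝ≥0∞).toReal ≤ (C * ‖ψ‖) ^ (2 : ℝ≥0∞).toReal := by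
    intro ψ s
    norm_num
    classical
    have h1 : ∑ m ∈ s, (‖w m‖ * ‖ψ (σ m)‖) ^ 2
        = ∑ m ∈ s.filter (· ∈ Function.support w), (‖w m‖ * ‖ψ (σ m)‖) ^ 2 := by
      refine (Finset.sum_filter_of_ne fun m _ h => ?_).symm
      contrapose! h
      simp [Function.notMem_support.1 h]
    have hsum : Summable fun k => ‖ψ k‖ ^ 2 := memℓp_two_iff.1 (lp.memℓp ψ)
    rw [h1, mul_pow, norm_sq_eq_tsum ψ]
    calc ∑ m ∈ s.filter (· ∈ Function.support w), (‖w m‖ * ‖ψ (σ m)‖) ^ 2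
        ≤ ∑ m ∈ s.filter (· ∈ Function.support w), C ^ 2 * ‖ψ (σ m)‖ ^ 2 := by
          refine Finset.sum_le_sum fun m _ => ?_
          rw [mul_pow]
          gcongr
          exact hw m
      _ = C ^ 2 * ∑ k ∈ (s.filter (· ∈ Function.support w)).image σ, ‖ψ k‖ ^ 2 := by
          rw [Finset.sum_image, Finset.mul_sum]
          intro a ha b hb hab
          exact hσ (Finset.mem_filter.1 ha).2 (Finset.mem_filter.1 hb).2 hab
      _ ≤ _ := by
          gcongr
          exact hsum.sum_le_tsum _ fun _ _ => by positivity
  refine ⟨LinearMap.mkContinuous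
    { toFun := fun ψ => ⟨fun m => w m * ψ (σ m), memℓp_gen' (key ψ)⟩
      map_add' := fun x y => by ext m; simp [mul_add]; rfl
      map_smul' := fun c x => by ext m; simp [mul_left_comm] } C fun ψ => ?_,
    LinearMap.mkContinuous_norm_le _ hC _, fun ψ m => rfl⟩
  exact lp.norm_le_of_forall_sum_le (by simp) (by positivity) (key ψ)

lemma oscHam_apply (ε g : ℝ) (f : ℕ → ℂ) (m : ℕ) :
    oscHam ε g f m = ε * (m * f m)
      + g * (Real.sqrt m * f (m - 1) + Real.sqrt (m + 1) * f (m + 1)) := by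
  simp only [oscHam, LinearMap.add_apply, LinearMap.smul_apply, Pi.add_apply, Pi.smul_apply,
    LinearMap.comp_apply, create_annihilate_apply, smul_eq_mul]
  rfl

/-- For `K` large, `ε b*b + g (b* + b) + iK` maps the domain of `b*b` onto the Fock space: it is a
perturbation of norm less than one of `ε b*b + iK`. -/
lemma exists_oscHam_add_eq (ε g : ℝ) (hε : 0 < ε) : ∃ K : ℝ, 0 < K ∧ ∀ φ : Cavity, ∃ ψ : Cavity,
    Memℓp (fun m : ℕ => (m : ℂ) * ψ m) 2 ∧ oscHam ε g ψ + (Complex.I * K) • (ψ : ℕ → ℂ) = φ := by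
  -- `C` exceeds `2|g|`, and `K` is large enough that `|εm + iK| ≥ C √(m + 1)`. Both ladder
  -- operators composed with the inverse of the diagonal part then have norm at most `1 / C`.
  set C : ℝ := 4 * |g| + 1 with hC
  have hC0 : 0 < C := by positivity
  set K : ℝ := C + C ^ 2 / ε with hK
  have hK0 : 0 < K := by positivity
  set d : ℕ → ℂ := fun m => ε * m + Complex.I * K with hd
  have hdn : ∀ m : ℕ, ‖d m‖ ^ 2 = (ε * m) ^ 2 + K ^ 2 := by
    intro m
    rw [← Complex.normSq_eq_norm_sq, Complex.normSq_apply]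
    simp [hd]
    ring
  have hd1 : ∀ m : ℕ, C * Real.sqrt (m + 1) ≤ ‖d m‖ := by
    intro m
    refine le_of_sq_le_sq ?_ (norm_nonneg _)
    rw [hdn, mul_pow, Real.sq_sqrt (by positivity)]
    have e : ε * (C ^ 2 / ε) = C ^ 2 := by field_simp
    have h0 : 0 ≤ C ^ 2 / ε := by positivity
    have hm : (0 : ℝ) ≤ m := by positivity
    have h1 : (ε * m) ^ 2 + (C ^ 2 / ε) ^ 2 ≥ 2 * C ^ 2 * m := by
      nlinarith [sq_nonneg (ε * m - C ^ 2 / ε)]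
    nlinarith [mul_nonneg hC0.le h0, mul_nonneg (sq_nonneg C) hm]
  have hdpos : ∀ m : ℕ, 0 < ‖d m‖ := fun m => lt_of_lt_of_le (by positivity) (hd1 m)
  have hd0 : ∀ m, d m ≠ 0 := fun m => norm_pos_iff.1 (hdpos m)
  have hd2 : ∀ m : ℕ, ε * m ≤ ‖d m‖ := by
    intro m
    refine le_of_sq_le_sq ?_ (norm_nonneg _)
    rw [hdn]
    nlinarith [sq_nonneg K]
  -- `R` inverts the diagonal part `ε b*b + iK`; `S = b*b R` shows that its range lies in the domain
  -- of `b*b`; `A = b R` and `B = b* R`. The Neumann series inverts `1 + g (A + B)`, and `R` applied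
  -- to that solution is the required vector.
  obtain ⟨R, -, hR⟩ := exists_weightedShift (fun m => 1 / d m) id (1 / C) (fun m => by
    rw [norm_div, norm_one]
    refine one_div_le_one_div_of_le hC0 (le_trans ?_ (hd1 m))
    exact le_mul_of_one_le_right hC0.le (Real.one_le_sqrt.2 (by simp))) Function.injective_id.injOn
  obtain ⟨S, -, hS⟩ := exists_weightedShift (fun m => m / d m) id (1 / ε) (fun m => by
    rw [norm_div, div_le_div_iff₀ (hdpos m) hε, Complex.norm_natCast]
    linarith [hd2 m]) Function.injective_id.injOn
  obtain ⟨A, hAn, hA⟩ := exists_weightedShift (fun m => Real.sqrt (m + 1) / d (m + 1)) (· + 1) (1 / C)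
    (fun m => by
      rw [norm_div, div_le_div_iff₀ (hdpos _) hC0, Complex.norm_real, Real.norm_eq_abs,
        abs_of_nonneg (Real.sqrt_nonneg _), one_mul, mul_comm]
      refine le_trans ?_ (hd1 (m + 1))
      gcongr
      linarith) (add_left_injective 1).injOn
  obtain ⟨B, hBn, hB⟩ := exists_weightedShift (fun m => Real.sqrt m / d (m - 1)) (· - 1) (1 / C)
    (fun m => by
      rw [norm_div, div_le_div_iff₀ (hdpos _) hC0, Complex.norm_real, Real.norm_eq_abs,
        abs_of_nonneg (Real.sqrt_nonneg _), one_mul, mul_comm]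
      refine le_trans ?_ (hd1 (m - 1))
      gcongr
      rcases m with _ | m <;> simp) (by
      intro a ha b hb hab
      have ha' : a ≠ 0 := by rintro rfl; simp at ha
      have hb' : b ≠ 0 := by rintro rfl; simp at hb
      simp only at hab
      omega)
  have hn : ‖-((g : ℂ) • (A + B))‖ < 1 := by
    rw [norm_neg, norm_smul, Complex.norm_real, Real.norm_eq_abs]
    calc |g| * ‖A + B‖ ≤ |g| * (1 / C + 1 / C) := by
          gcongr
          exact (norm_add_le _ _).trans (add_le_add hAn hBn)
      _ = 2 * |g| / C := by ring
      _ < 1 := by rw [div_lt_one hC0, hC]; linarith [abs_nonneg g]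
  obtain ⟨u, hu⟩ := isUnit_one_sub_of_norm_lt_one hn
  refine ⟨K, hK0, fun φ => ?_⟩
  set y : Cavity := (↑u⁻¹ : Op ℕ) φ with hy
  have huy : y + (g : ℂ) • (A y + B y) = φ := by
    have h1 : (u : Op ℕ) y = φ := by
      rw [hy, ← mul_apply_eq_comp, Units.mul_inv, one_apply_eq_self]
    rw [← h1, hu, sub_neg_eq_add]
    rfl
  refine ⟨R y, ?_, ?_⟩
  · convert lp.memℓp (S y) using 1
    ext m
    rw [hR, hS]
    simp only [id]
    ring
  · ext m
    rw [← huy]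
    simp only [Pi.add_apply, Pi.smul_apply, oscHam_apply, lp.coeFn_add, lp.coeFn_smul, smul_eq_mul,
      hR, hA, hB, id]
    have h := hd0 m
    have e : (ε : ℂ) * m + Complex.I * K = d m := rfl
    have e2 : 1 / d m * y m * (ε * m + Complex.I * K) = y m := by rw [e]; field_simp
    linear_combination e2

/-- Injectivity of `H + iK`: a vector in its kernel would have derivative `-K` times itself, hence a
decreasing norm, against isometry. -/
lemma norm_sub_eq_zero_of_generator {E : Type} [NormedAddCommGroup E] [InnerProductSpace ℂ E]
    {U : ℝ → E →L[ℂ] E} (hn : ∀ t ψ, ‖U t ψ‖ = ‖ψ‖) (h0 : U 0 = 1) {ψ χ φ φ' : E} {K : ℝ}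
    (hK : 0 < K) (h : HasDerivAt (fun t => U t ψ) (-Complex.I • φ) 0)
    (h' : HasDerivAt (fun t => U t χ) (-Complex.I • φ') 0)
    (he : φ + (Complex.I * K) • ψ = φ' + (Complex.I * K) • χ) : ψ = χ := by
  have h1 : HasDerivAt (fun t => U t (ψ - χ)) (-(K : ℂ) • (ψ - χ)) 0 := by
    have h2 := h.sub h'
    have h3 : (fun t => U t (ψ - χ)) = (fun t => U t ψ) - fun t => U t χ := by
      ext t; simp
    rw [h3]
    refine h2.congr_deriv ?_
    have h4 : φ - φ' = -(Complex.I * K) • (ψ - χ) := by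
      rw [neg_smul, smul_sub, eq_comm, neg_sub, sub_eq_sub_iff_add_eq_add, add_comm, ← he]
    rw [← smul_sub, h4, smul_smul]
    congr 1
    linear_combination (K : ℂ) * Complex.I_mul_I
  have h2 := inner_add_inner_eq_zero_of_hasDerivAt hn h0 h1
  rw [inner_smul_left, inner_smul_right, map_neg, Complex.conj_ofReal, ← two_mul,
    mul_eq_zero, mul_eq_zero] at h2
  have : (K : ℂ) ≠ 0 := by exact_mod_cast hK.ne'
  simpa [this, sub_eq_zero] using h2

/-- Testing against exponential vectors upgrades the weak equation to `U_t ψ = ψ - i ∫ U_s φ ds`.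
The integrand is norm continuous, so the integral can be differentiated strongly. -/
lemma hasDerivAt_oscGroup_of_eq (ε β g : ℝ) (hg : g = ε * β) {ψ φ : Cavity}
    (h : oscHam ε g ψ = φ) :
    HasDerivAt (fun t => oscGroup ε β t ψ) (-Complex.I • φ) 0 := by
  have hcont := (continuous_oscGroup ε β φ).const_smul (-Complex.I)
  have hI : ∀ t, HasDerivAt (fun t => ∫ s in (0 : ℝ)..t, -Complex.I • oscGroup ε β s φ)
      (-Complex.I • oscGroup ε β t φ) t := fun t =>
    intervalIntegral.integral_hasDerivAt_right (hcont.intervalIntegrable _ _)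
      hcont.aestronglyMeasurable.stronglyMeasurableAtFilter hcont.continuousAt
  have key : ∀ t, oscGroup ε β t ψ = (∫ s in (0 : ℝ)..t, -Complex.I • oscGroup ε β s φ) + ψ := by
    intro t
    refine eq_of_inner_expVec fun z => ?_
    have hd : ∀ t, HasDerivAt (fun t => ⟪expVec z, oscGroup ε β t ψ⟫_ℂ
        - ⟪expVec z, ∫ s in (0 : ℝ)..t, -Complex.I • oscGroup ε β s φ⟫_ℂ) 0 t := by
      intro t
      have h1 := hasDerivAt_fockSeries_oscGroup ε β g hg h (conj z) t
      have h2 := (hasDerivAt_const t (expVec z)).inner ℂ (hI t)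
      simp only [← inner_expVec] at h1
      refine (h1.sub h2).congr_deriv ?_
      rw [inner_smul_right, inner_zero_left, add_zero, sub_self]
    have hc := is_const_of_deriv_eq_zero (fun s => (hd s).differentiableAt)
      (fun s => (hd s).deriv) t 0
    simp only [intervalIntegral.integral_same, inner_zero_right, sub_zero, oscGroup_zero,
      one_apply_eq_self] at hc
    rw [inner_add_right, ← hc]
    ring
  have h0 := (hI 0).add_const ψ
  rw [oscGroup_zero, one_apply_eq_self] at h0
  rw [show (fun t => oscGroup ε β t ψ) = _ from funext key]
  exact h0

/-- The generator extends the Hamiltonian on the domain of `b*b`. There `H + iK` is already onto,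
while for the generator it is injective, so the extension cannot be proper. -/
theorem hasDerivAt_oscGroup_iff {ε β g : ℝ} (hε : 0 < ε) (hg : g = ε * β) (ψ φ : Cavity) :
    HasDerivAt (fun t => oscGroup ε β t ψ) (-Complex.I • φ) 0
      ↔ Memℓp (fun m : ℕ => (m : ℂ) * ψ m) 2 ∧ oscHam ε g ψ = φ := by
  refine ⟨fun h => ?_, fun h => hasDerivAt_oscGroup_of_eq ε β g hg h.2⟩
  obtain ⟨K, hK, hs⟩ := exists_oscHam_add_eq ε g hε
  obtain ⟨χ, hχ, he⟩ := hs (φ + (Complex.I * K) • ψ)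
  set φ' : Cavity := φ + (Complex.I * K) • ψ - (Complex.I * K) • χ with hφ'
  have h1 : oscHam ε g χ = φ' := by
    rw [hφ', lp.coeFn_sub, ← he, lp.coeFn_smul, add_sub_cancel_right]
  have h2 : ψ = χ := norm_sub_eq_zero_of_generator (norm_oscGroup ε β) (oscGroup_zero ε β) hK h
    (hasDerivAt_oscGroup_of_eq ε β g hg h1) (by rw [hφ', sub_add_cancel])
  subst h2
  refine ⟨hχ, ?_⟩
  rw [h1, hφ', add_sub_cancel_right]

/-! ### Graphs of maximal operators -/

lemma mem_graph_maxOp {ι : Type} (A : (ι → ℂ) →ₗ[ℂ] (ι → ℂ)) (ψ φ : L2 ι) :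
    (ψ, φ) ∈ (maxOp A).graph ↔ A ψ = φ := by
  rw [LinearPMap.mem_graph_iff]
  constructor
  · rintro ⟨x, rfl, h⟩
    exact congrArg (fun v : L2 ι => (v : ι → ℂ)) h
  · intro h
    refine ⟨⟨ψ, ?_⟩, rfl, ?_⟩
    · change Memℓp (A ψ) 2
      rw [h]
      exact lp.memℓp φ
    · exact lp.ext h

lemma dense_of_single_mem {ι : Type} [DecidableEq ι] (D : Submodule ℂ (L2 ι))
    (h : ∀ i (a : ℂ), lp.single 2 i a ∈ D) : Dense (D : Set (L2 ι)) := by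
  intro ψ
  exact mem_closure_of_tendsto (lp.hasSum_single (by simp) ψ)
    (Filter.Eventually.of_forall fun s => D.sum_mem fun i _ => h i _)

lemma isUnitaryGroup_oscGroup {ε β g : ℝ} (hε : 0 < ε) (hg : g = ε * β) {H : Cavity →ₗ.[ℂ] Cavity}
    (hH : ∀ ψ φ, (ψ, φ) ∈ H.graph
      ↔ Memℓp (fun m : ℕ => (m : ℂ) * ψ m) 2 ∧ oscHam ε g ψ = φ) :
    IsUnitaryGroup H (oscGroup ε β) where
  unitary := oscGroup_mem_unitary ε β
  zero := oscGroup_zero ε β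
  add := oscGroup_add ε β
  continuous := continuous_oscGroup ε β
  generator ψ φ := (hH ψ φ).trans (hasDerivAt_oscGroup_iff hε hg ψ φ).symm

lemma isUnitaryGroup_numberOp : IsUnitaryGroup numberOp (oscGroup 1 0) := by
  refine isUnitaryGroup_oscGroup (g := 0) one_pos (by simp) fun ψ φ => ?_
  have h : oscHam 1 0 ψ = (create ∘ₗ annihilate) ψ := by simp [oscHam]
  rw [numberOp, mem_graph_maxOp, h, iff_and_self]
  intro h'
  have e : (create ∘ₗ annihilate) (ψ : ℕ → ℂ) = fun m : ℕ => (m : ℂ) * ψ m :=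
    funext fun m => create_annihilate_apply _ m
  rw [← e, h']
  exact lp.memℓp φ

lemma propagator_numberOp (t : ℝ) : propagator numberOp t = oscGroup 1 0 t := by
  refine isUnitaryGroup_numberOp.propagator_eq (dense_of_single_mem _ fun m a => ?_) t
  have h := Submodule.smul_mem _ a (LinearPMap.mem_domain_of_mem_graph (numberState_mem_graph m))
  rwa [numberState, ← lp.single_smul, smul_eq_mul, mul_one] at h

/-! ### Operators that are diagonal in the levels of the atoms -/

lemma slice_apply {n : ℕ} (s : Fin n → Bool) (ψ : L2 (Label n)) (m : ℕ) :
    slice s ψ m = ψ (m, s) := rfl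

lemma ext_slice {n : ℕ} {ψ φ : L2 (Label n)} (h : ∀ s, slice s ψ = slice s φ) : ψ = φ := by
  ext ⟨m, s⟩
  rw [← slice_apply, h, slice_apply]

lemma slice_adjoint_slice {n : ℕ} (s s' : Fin n → Bool) (χ : Cavity) :
    slice s (ContinuousLinearMap.adjoint (slice s') χ) = if s = s' then χ else 0 := by
  ext m
  have h1 : ∀ v : L2 (Label n), v (m, s) = ⟪(lp.single 2 (m, s) (1 : ℂ) : L2 (Label n)), v⟫_ℂ := by
    intro v
    rw [lp.inner_single_left]; simp
  have h2 : slice s' (lp.single 2 (m, s) (1 : ℂ) : L2 (Label n))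
      = if s = s' then numberState m else 0 := by
    ext k
    rw [slice_apply]
    by_cases h : s = s'
    · subst h
      by_cases hk : k = m
      · subst hk; simp [numberState]
      · simp [numberState, hk]
    · simp [h, Ne.symm h]
  rw [slice_apply, h1, ContinuousLinearMap.adjoint_inner_right, h2]
  split_ifs
  · rw [numberState, lp.inner_single_left]; simp
  · simp

/-- The operator that acts as `A s` on the cavity while the atoms are in the levels `s`. -/
def blockOp {n : ℕ} (A : (Fin n → Bool) → Op ℕ) : Op (Label n) :=
  ∑ s, ContinuousLinearMap.adjoint (slice s) ∘L A s ∘L slice s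

lemma slice_blockOp {n : ℕ} (A : (Fin n → Bool) → Op ℕ) (s : Fin n → Bool) (ψ : L2 (Label n)) :
    slice s (blockOp A ψ) = A s (slice s ψ) := by
  simp [blockOp, map_sum, slice_adjoint_slice]

lemma blockOp_mul {n : ℕ} (A B : (Fin n → Bool) → Op ℕ) :
    blockOp A * blockOp B = blockOp (fun s => A s * B s) := by
  refine ContinuousLinearMap.ext fun ψ => ext_slice fun s => ?_
  rw [mul_apply_eq_comp, slice_blockOp, slice_blockOp, slice_blockOp, mul_apply_eq_comp]

lemma blockOp_one {n : ℕ} : blockOp (fun _ : Fin n → Bool => (1 : Op ℕ)) = 1 := by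
  refine ContinuousLinearMap.ext fun ψ => ext_slice fun s => ?_
  rw [slice_blockOp]; simp

lemma star_blockOp {n : ℕ} (A : (Fin n → Bool) → Op ℕ) :
    star (blockOp A) = blockOp (fun s => star (A s)) := by
  simp only [blockOp, star_sum, ContinuousLinearMap.star_eq_adjoint,
    ContinuousLinearMap.adjoint_comp, ContinuousLinearMap.adjoint_adjoint]
  rfl

lemma traceAtoms_blockOp {n : ℕ} (A : (Fin n → Bool) → Op ℕ) :
    traceAtoms (blockOp A) = ∑ s, A s := by
  refine Finset.sum_congr rfl fun s _ => ContinuousLinearMap.ext fun χ => ?_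
  simp [slice_blockOp, slice_adjoint_slice]

lemma memℓp_of_slices {n : ℕ} {f : Label n → ℂ} (h : ∀ s, Memℓp (fun m => f (m, s)) 2) :
    Memℓp f 2 := by
  set v : L2 (Label n) := ∑ s, ContinuousLinearMap.adjoint (slice s) ⟨_, h s⟩ with hv
  have : f = v := by
    ext ⟨m, s⟩
    rw [← slice_apply, hv, map_sum]
    simp [slice_adjoint_slice]
  rw [this]
  exact lp.memℓp v

/-! ### The propagator of the coupled system -/

lemma onAtom_lowering_apply {n : ℕ} (j : Fin n) (f : Label n → ℂ) (m : ℕ) (s : Fin n → Bool) :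
    (onAtom j lowering.conjTranspose ∘ₗ onAtom j lowering) f (m, s)
      = if s j then f (m, s) else 0 := by
  cases h : s j <;> simp [onAtom, lowering, h, Matrix.single_apply]
  rw [← h, Function.update_eq_self]

/-- The number of excited atoms. -/
def excitedCount {n : ℕ} (s : Fin n → Bool) : ℕ := ∑ j, if s j then 1 else 0

lemma atomEnergy_apply {n : ℕ} (f : Label n → ℂ) (m : ℕ) (s : Fin n → Bool) :
    (∑ j, onAtom j lowering.conjTranspose ∘ₗ onAtom j lowering : (Label n → ℂ) →ₗ[ℂ] _) f (m, s)
      = excitedCount s * f (m, s) := by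
  rw [LinearMap.sum_apply, Finset.sum_apply]
  simp only [onAtom_lowering_apply, excitedCount]
  push_cast
  rw [Finset.sum_mul]
  simp

lemma interaction_apply {n : ℕ} (k : Fin n) (f : Label n → ℂ) (m : ℕ) (s : Fin n → Bool) :
    (onCavity (create + annihilate)
        ∘ₗ onAtom k lowering.conjTranspose ∘ₗ onAtom k lowering) f (m, s)
      = if s k then (create + annihilate) (fun m => f (m, s)) m else 0 := by
  have h : (fun m' => (onAtom k lowering.conjTranspose ∘ₗ onAtom k lowering) f (m', s))
      = if s k then (fun m => f (m, s)) else 0 := by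
    ext m'
    rw [onAtom_lowering_apply]
    split_ifs <;> rfl
  change (create + annihilate)
    (fun m' => (onAtom k lowering.conjTranspose ∘ₗ onAtom k lowering) f (m', s)) m = _
  rw [h]
  split_ifs
  · rfl
  · simp

/-- Relative boundedness: both ladder terms are bounded weighted shifts of the sequence `(m + 1) f
m`. -/
lemma memℓp_create_add_annihilate {f : ℕ → ℂ} (h0 : Memℓp f 2)
    (h : Memℓp (fun m : ℕ => (m : ℂ) * f m) 2) : Memℓp ((create + annihilate) f) 2 := by
  have hn : ∀ m : ℕ, ‖(m : ℂ) + 1‖ = m + 1 := fun m => by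
    rw [← Nat.cast_add_one, Complex.norm_natCast]; push_cast; rfl
  have hb : ∀ x : ℝ, 1 ≤ x → Real.sqrt x ≤ x := fun x hx => by
    rw [Real.sqrt_le_left (by linarith)]; nlinarith
  set y : Cavity := ⟨_, h.add h0⟩ with hy
  have hy' : ∀ m, y m = ((m : ℂ) + 1) * f m := fun m => by
    change (m : ℂ) * f m + f m = _
    ring
  obtain ⟨A, -, hA⟩ := exists_weightedShift (fun m => Real.sqrt (m + 1) / ((m : ℂ) + 1 + 1)) (· + 1) 1
    (fun m => by
      have := hn (m + 1)
      push_cast at this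
      rw [norm_div, this, Complex.norm_real, Real.norm_eq_abs, abs_of_nonneg (Real.sqrt_nonneg _),
        div_le_one (by positivity)]
      linarith [hb (m + 1) (by simp)]) (add_left_injective 1).injOn
  obtain ⟨B, -, hB⟩ := exists_weightedShift (fun m => Real.sqrt m / (((m - 1 : ℕ) : ℂ) + 1)) (· - 1) 1
    (fun m => by
      rw [norm_div, hn, Complex.norm_real, Real.norm_eq_abs, abs_of_nonneg (Real.sqrt_nonneg _),
        div_le_one (by positivity)]
      rcases m with _ | m
      · simp
      · simp [hb (m + 1)]) (by
      intro a ha b hb hab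
      have ha' : a ≠ 0 := by rintro rfl; simp at ha
      have hb' : b ≠ 0 := by rintro rfl; simp at hb
      simp only at hab
      omega)
  convert lp.memℓp (B y + A y) using 1
  ext m
  have e1 : ((m : ℂ) + 1 + 1) ≠ 0 := by exact_mod_cast Nat.succ_ne_zero (m + 1)
  have e2 : (((m - 1 : ℕ) : ℂ) + 1) ≠ 0 := by exact_mod_cast Nat.succ_ne_zero (m - 1)
  rw [lp.coeFn_add, Pi.add_apply, hA, hB, hy', hy']
  simp only [create, annihilate, LinearMap.add_apply, Pi.add_apply, LinearMap.coe_mk,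
    AddHom.coe_mk]
  push_cast
  field_simp

lemma maxOp_apply {ι : Type} (A : (ι → ℂ) →ₗ[ℂ] (ι → ℂ)) (ψ : (maxOp A).domain) :
    ((maxOp A ψ : L2 ι) : ι → ℂ) = A (ψ : L2 ι) := rfl

lemma maxOp_combination_apply {ι : Type} (a b c : ℂ) (A B C : (ι → ℂ) →ₗ[ℂ] (ι → ℂ))
    (ψ : (a • maxOp A + b • maxOp B + c • maxOp C).domain) (i : ι) :
    ((a • maxOp A + b • maxOp B + c • maxOp C) ψ) i
      = a * A (ψ : L2 ι) i + b * B (ψ : L2 ι) i + c * C (ψ : L2 ι) i := by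
  rw [LinearPMap.add_apply, LinearPMap.add_apply, LinearPMap.smul_apply, LinearPMap.smul_apply,
    LinearPMap.smul_apply, lp.coeFn_add, lp.coeFn_add, lp.coeFn_smul, lp.coeFn_smul, lp.coeFn_smul,
    maxOp_apply, maxOp_apply, maxOp_apply]
  rfl

/-- Only the photon number restricts the domain: the atomic energy is bounded and the interaction is
controlled by `b*b`. -/
lemma mem_domain_hamiltonian (ε E g : ℝ) {n : ℕ} (k : Fin n) (ψ : L2 (Label n)) :
    ψ ∈ (hamiltonian ε E g n k).domain
      ↔ ∀ s, Memℓp (fun m : ℕ => (m : ℂ) * ψ (m, s)) 2 := by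
  have h1 : ψ ∈ (hamiltonian ε E g n k).domain
      ↔ (Memℓp (onCavity (create ∘ₗ annihilate) ψ) 2
        ∧ Memℓp ((∑ j, onAtom j lowering.conjTranspose ∘ₗ onAtom j lowering :
            (Label n → ℂ) →ₗ[ℂ] _) ψ) 2)
        ∧ Memℓp ((onCavity (create + annihilate)
            ∘ₗ onAtom k lowering.conjTranspose ∘ₗ onAtom k lowering) ψ) 2 := Iff.rfl
  have e1 : onCavity (create ∘ₗ annihilate) ψ = fun x : Label n => (x.1 : ℂ) * ψ x :=
    funext fun x => create_annihilate_apply _ x.1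
  rw [h1, e1]
  constructor
  · rintro ⟨⟨h, -⟩, -⟩ s
    exact memℓp_slice s ⟨_, h⟩
  · intro h
    refine ⟨⟨memℓp_of_slices h, memℓp_of_slices fun s => ?_⟩, memℓp_of_slices fun s => ?_⟩
    · simp only [atomEnergy_apply]
      exact (memℓp_slice s ψ).const_smul (excitedCount s : ℂ)
    · simp only [interaction_apply]
      split_ifs
      · exact memℓp_create_add_annihilate (memℓp_slice s ψ) (h s)
      · exact zero_memℓp

lemma hamiltonian_apply (ε E g : ℝ) {n : ℕ} (k : Fin n)
    (ψ : (hamiltonian ε E g n k).domain) (s : Fin n → Bool) :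
    (slice s (hamiltonian ε E g n k ψ) : ℕ → ℂ)
      = oscHam ε (if s k then g else 0) (slice s ψ) + ((E * excitedCount s : ℝ) : ℂ) • slice s ψ := by
  ext m
  have h1 : (hamiltonian ε E g n k ψ) (m, s)
      = ε * onCavity (create ∘ₗ annihilate) ψ (m, s)
        + E * (∑ j, onAtom j lowering.conjTranspose ∘ₗ onAtom j lowering :
            (Label n → ℂ) →ₗ[ℂ] _) ψ (m, s)
        + g * (onCavity (create + annihilate)
            ∘ₗ onAtom k lowering.conjTranspose ∘ₗ onAtom k lowering) ψ (m, s) :=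
    maxOp_combination_apply _ _ _ _ _ _ ψ (m, s)
  rw [slice_apply, h1, atomEnergy_apply, interaction_apply]
  have h2 : onCavity (create ∘ₗ annihilate) ψ (m, s)
      = (create ∘ₗ annihilate) (slice s ψ : ℕ → ℂ) m := rfl
  have h3 : (fun m => (ψ : L2 (Label n)) (m, s)) = (slice s (ψ : L2 (Label n)) : ℕ → ℂ) := rfl
  rw [h2, h3, ← slice_apply]
  simp only [oscHam, LinearMap.add_apply, LinearMap.smul_apply, Pi.add_apply, Pi.smul_apply,
    smul_eq_mul]
  split_ifs <;> push_cast <;> simp <;> ring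

lemma mem_graph_hamiltonian (ε E g : ℝ) {n : ℕ} (k : Fin n) (ψ φ : L2 (Label n)) :
    (ψ, φ) ∈ (hamiltonian ε E g n k).graph
      ↔ ∀ s, Memℓp (fun m : ℕ => (m : ℂ) * slice s ψ m) 2
        ∧ oscHam ε (if s k then g else 0) (slice s ψ) + ((E * excitedCount s : ℝ) : ℂ) • slice s ψ
          = (slice s φ : ℕ → ℂ) := by
  rw [LinearPMap.mem_graph_iff, forall_and]
  constructor
  · rintro ⟨x, rfl, rfl⟩
    exact ⟨(mem_domain_hamiltonian ε E g k _).1 x.2, fun s => (hamiltonian_apply ε E g k x s).symm⟩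
  · rintro ⟨h1, h2⟩
    refine ⟨⟨ψ, (mem_domain_hamiltonian ε E g k _).2 h1⟩, rfl, ext_slice fun s => lp.ext ?_⟩
    rw [hamiltonian_apply, ← h2]

lemma dense_domain_hamiltonian (ε E g : ℝ) {n : ℕ} (k : Fin n) :
    Dense ((hamiltonian ε E g n k).domain : Set (L2 (Label n))) := by
  refine dense_of_single_mem _ fun x a => (mem_domain_hamiltonian ε E g k _).2 fun s => ?_
  convert (memℓp_slice s (lp.single 2 x a : L2 (Label n))).const_smul (x.1 : ℂ) using 1
  ext m
  by_cases h : m = x.1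
  · simp [h]
  · have : ((m, s) : Label n) ≠ x := fun e => h (by rw [← e])
    simp [this]

/-- The phase `e^{-iet}` shifts the generator by `e`. -/
lemma hasDerivAt_phase_smul_iff (e : ℝ) (f : ℝ → Cavity) (φ : Cavity) :
    HasDerivAt (fun t => rot e t • f t) (-Complex.I • φ) 0
      ↔ HasDerivAt f (-Complex.I • (φ - (e : ℂ) • f 0)) 0 := by
  have key : ∀ (e : ℝ) (f : ℝ → Cavity) (φ : Cavity), HasDerivAt f (-Complex.I • φ) 0 →
      HasDerivAt (fun t => rot e t • f t) (-Complex.I • (φ + (e : ℂ) • f 0)) 0 := by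
    intro e f φ h
    refine ((hasDerivAt_rot e 0).smul h).congr_deriv ?_
    rw [rot_zero, one_smul, mul_one, smul_add, smul_smul, neg_mul]
  constructor
  · intro h
    have h1 := key (-e) _ _ h
    have h2 : (fun t => rot (-e) t • rot e t • f t) = f := by
      ext1 t
      rw [smul_smul, rot, rot, ← Complex.exp_add]
      push_cast
      rw [show -(Complex.I * -(e : ℂ) * t) + -(Complex.I * e * t) = 0 by ring, Complex.exp_zero,
        one_smul]
    rw [h2, rot_zero, one_smul] at h1
    refine h1.congr_deriv ?_
    push_cast
    rw [neg_smul (e : ℂ), sub_eq_add_neg]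
  · intro h
    have h1 := key e _ _ h
    rwa [sub_add_cancel] at h1

/-- The displacement parameter `λ/ε` for an excited atom, and `0` for an atom in the ground
state. -/
def coupling (ε g : ℝ) (b : Bool) : ℝ := if b then g / ε else 0

/-- The propagator while the `k`-th atom is in the cavity. -/
def blockPropagator (ε E g : ℝ) {n : ℕ} (k : Fin n) (t : ℝ) : Op (Label n) :=
  blockOp fun s => rot (E * excitedCount s) t • oscGroup ε (coupling ε g (s k)) t

lemma slice_blockPropagator (ε E g : ℝ) {n : ℕ} (k : Fin n) (t : ℝ) (s : Fin n → Bool)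
    (ψ : L2 (Label n)) : slice s (blockPropagator ε E g k t ψ)
      = rot (E * excitedCount s) t • oscGroup ε (coupling ε g (s k)) t (slice s ψ) :=
  slice_blockOp _ _ _

lemma eq_sum_slice {n : ℕ} (ψ : L2 (Label n)) :
    ψ = ∑ s, ContinuousLinearMap.adjoint (slice s) (slice s ψ) := by
  refine ext_slice fun s => ?_
  rw [map_sum]
  simp [slice_adjoint_slice]

lemma hasDerivAt_iff_slice {n : ℕ} {f : ℝ → L2 (Label n)} {ξ : L2 (Label n)} {t : ℝ} :
    HasDerivAt f ξ t ↔ ∀ s, HasDerivAt (fun t => slice s (f t)) (slice s ξ) t := by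
  constructor
  · intro h s
    exact ((slice s).restrictScalars ℝ).hasFDerivAt.comp_hasDerivAt t h
  · intro h
    rw [eq_sum_slice ξ, show f = fun t => ∑ s, ContinuousLinearMap.adjoint (slice s) (slice s (f t))
      from funext fun t => eq_sum_slice (f t)]
    refine HasDerivAt.fun_sum fun s _ => ?_
    exact ((ContinuousLinearMap.adjoint (slice s)).restrictScalars ℝ).hasFDerivAt.comp_hasDerivAt t
      (h s)

lemma isUnitaryGroup_blockPropagator {ε : ℝ} (hε : 0 < ε) (E g : ℝ) {n : ℕ} (k : Fin n) :
    IsUnitaryGroup (hamiltonian ε E g n k) (blockPropagator ε E g k) := by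
  have hstar : ∀ t, star (blockPropagator ε E g k t) = blockPropagator ε E g k (-t) := by
    intro t
    simp only [blockPropagator, star_blockOp, star_smul, star_oscGroup]
    congr 1
    ext1 s
    rw [← conj_rot]
    rfl
  have hzero : blockPropagator ε E g k 0 = 1 := by
    simp only [blockPropagator, rot_zero, oscGroup_zero, one_smul, blockOp_one]
  have hadd : ∀ t t', blockPropagator ε E g k (t + t')
      = blockPropagator ε E g k t * blockPropagator ε E g k t' := by
    intro t t'
    simp only [blockPropagator, blockOp_mul, rot_add, oscGroup_add, smul_mul_smul_comm]
  refine ⟨fun t => ?_, hzero, hadd, fun ψ => ?_, fun ψ φ => ?_⟩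
  · rw [Unitary.mem_iff, hstar, ← hadd, ← hadd, neg_add_cancel, add_neg_cancel, hzero]
    exact ⟨rfl, rfl⟩
  · rw [show (fun t => blockPropagator ε E g k t ψ) = fun t => ∑ s,
      ContinuousLinearMap.adjoint (slice s) (slice s (blockPropagator ε E g k t ψ))
      from funext fun t => eq_sum_slice _]
    refine continuous_finsetSum _ fun s _ => ?_
    refine (ContinuousLinearMap.continuous _).comp ?_
    simp only [slice_blockPropagator]
    exact (continuous_rot _).smul (continuous_oscGroup _ _ _)
  · refine (mem_graph_hamiltonian ε E g k ψ φ).trans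
      (Iff.trans (forall_congr' fun s => ?_) hasDerivAt_iff_slice.symm)
    simp only [slice_blockPropagator, map_smul]
    rw [hasDerivAt_phase_smul_iff, oscGroup_zero, one_apply_eq_self,
      hasDerivAt_oscGroup_iff (g := if s k then g else 0) hε
        (by rw [coupling]; split_ifs; exacts [by field_simp, by simp]), lp.coeFn_sub, lp.coeFn_smul,
      eq_sub_iff_add_eq]

lemma propagator_hamiltonian {ε : ℝ} (hε : 0 < ε) (E g : ℝ) {n : ℕ} (k : Fin n) (t : ℝ) :
    propagator (hamiltonian ε E g n k) t = blockPropagator ε E g k t :=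
  (isUnitaryGroup_blockPropagator hε E g k).propagator_eq (dense_domain_hamiltonian ε E g k) t

/-! ### The cavity state as an iterate of the one-step map -/

/-- The evolution of the cavity state during one period, for an atom in the level `b`. -/
def levelMap (ε g τ : ℝ) (b : Bool) : Op ℕ →ₗ[ℂ] Op ℕ :=
  LinearMap.mulLeftRight ℂ (oscGroup ε (coupling ε g b) τ, star (oscGroup ε (coupling ε g b) τ))

lemma levelMap_apply (ε g τ : ℝ) (b : Bool) (X : Op ℕ) :
    levelMap ε g τ b X = oscGroup ε (coupling ε g b) τ * X
      * star (oscGroup ε (coupling ε g b) τ) := by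
  simp [levelMap]

/-- The mixture of the evolutions for the two levels. -/
def mixedMap (ε g τ : ℝ) (r : Matrix Bool Bool ℂ) : Op ℕ →ₗ[ℂ] Op ℕ :=
  ∑ b, r b b • levelMap ε g τ b

lemma mixedMap_apply (ε g τ : ℝ) (r : Matrix Bool Bool ℂ) (X : Op ℕ) :
    mixedMap ε g τ r X = ∑ b, r b b • levelMap ε g τ b X := by
  rw [mixedMap, LinearMap.sum_apply]
  rfl

lemma lowering_conjTranspose_mul : lowering.conjTranspose * lowering = Matrix.single true true 1 := by
  ext i j
  cases i <;> cases j <;> simp [lowering, Matrix.mul_apply, Matrix.single_apply]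

lemma IsAtomState.apply_eq_zero {r : Matrix Bool Bool ℂ} (hr : IsAtomState r) {b b' : Bool}
    (h : b ≠ b') : r b b' = 0 := by
  have h1 := hr.gauge.eq
  rw [lowering_conjTranspose_mul] at h1
  cases b <;> cases b'
  · exact absurd rfl h
  · have := congrFun (congrFun h1 false) true
    simpa [Matrix.mul_apply, Matrix.single_apply] using this
  · have := congrFun (congrFun h1 true) false
    simpa [Matrix.mul_apply, Matrix.single_apply] using this.symm
  · exact absurd rfl h

lemma productState_eq {r : Matrix Bool Bool ℂ} (hr : IsAtomState r) (n : ℕ) (ρ : Op ℕ) :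
    productState n ρ r = blockOp (fun s => (∏ k, r (s k) (s k)) • ρ) := by
  refine Finset.sum_congr rfl fun s _ => ?_
  rw [Finset.sum_eq_single s]
  · refine ContinuousLinearMap.ext fun ψ => ?_
    simp
  · intro s' _ hs'
    obtain ⟨k, hk⟩ := Function.ne_iff.1 hs'
    rw [Finset.prod_eq_zero (Finset.mem_univ k) (hr.apply_eq_zero hk.symm), zero_smul]
  · simp

/-- Conjugation cancels the scalar phase of each block, so the atomic energy `E` disappears from the
evolution of block-diagonal states. -/
lemma propagator_conj_blockOp {ε : ℝ} (hε : 0 < ε) (E g τ : ℝ) {n : ℕ} (k : Fin n)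
    (X : (Fin n → Bool) → Op ℕ) :
    propagator (hamiltonian ε E g n k) τ * blockOp X * propagator (hamiltonian ε E g n k) (-τ)
      = blockOp (fun s => levelMap ε g τ (s k) (X s)) := by
  rw [propagator_hamiltonian hε, propagator_hamiltonian hε, blockPropagator, blockPropagator,
    blockOp_mul, blockOp_mul]
  congr 1
  ext1 s
  rw [levelMap_apply, star_oscGroup, smul_mul_assoc, smul_mul_assoc, mul_smul_comm, smul_smul,
    mul_comm, rot_neg_mul, one_smul]

/-- The index map `i` lets the number of steps vary in the induction while the number of atoms stays
fixed. -/
lemma foldl_conj_blockOp {ε : ℝ} (hε : 0 < ε) (E g τ : ℝ) {n : ℕ} (X : (Fin n → Bool) → Op ℕ)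
    (m : ℕ) (i : Fin m → Fin n) :
    Fin.foldl m (fun T k => propagator (hamiltonian ε E g n (i k)) τ * T
        * propagator (hamiltonian ε E g n (i k)) (-τ)) (blockOp X)
      = blockOp (fun s => Fin.foldl m (fun Y k => levelMap ε g τ (s (i k)) Y) (X s)) := by
  induction m with
  | zero => simp only [Fin.foldl_zero]
  | succ m ih =>
    simp only [Fin.foldl_succ_last]
    rw [ih fun k => i k.castSucc, propagator_conj_blockOp hε]

lemma cavityState_eq_sum {ε : ℝ} (hε : 0 < ε) (E g τ : ℝ) {r : Matrix Bool Bool ℂ}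
    (hr : IsAtomState r) (ρ : Op ℕ) (n : ℕ) :
    cavityState ε E g τ r ρ n = ∑ s : Fin n → Bool,
      Fin.foldl n (fun Y k => levelMap ε g τ (s k) Y) ((∏ k, r (s k) (s k)) • ρ) := by
  rw [cavityState, jointState, productState_eq hr]
  exact (congrArg traceAtoms (foldl_conj_blockOp hε E g τ _ n id)).trans (traceAtoms_blockOp _)

lemma foldl_levelMap_smul (ε g τ : ℝ) (n : ℕ) (s : Fin n → Bool) (c : ℂ) (ρ : Op ℕ) :
    Fin.foldl n (fun Y k => levelMap ε g τ (s k) Y) (c • ρ)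
      = c • Fin.foldl n (fun Y k => levelMap ε g τ (s k) Y) ρ := by
  induction n with
  | zero => simp only [Fin.foldl_zero]
  | succ n ih =>
    simp only [Fin.foldl_succ_last]
    rw [ih fun k => s k.castSucc, map_smul]

/-- The product weights factor. Splitting off the last atom with `Fin.snocEquiv` makes its sum one
more application of the mixture. -/
lemma sum_foldl_eq_iterate (ε g τ : ℝ) (r : Matrix Bool Bool ℂ) (ρ : Op ℕ) (n : ℕ) :
    ∑ s : Fin n → Bool,
        Fin.foldl n (fun Y k => levelMap ε g τ (s k) Y) ((∏ k, r (s k) (s k)) • ρ)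
      = (mixedMap ε g τ r)^[n] ρ := by
  simp only [foldl_levelMap_smul]
  induction n with
  | zero => simp
  | succ n ih =>
    rw [Function.iterate_succ_apply', ← ih, mixedMap_apply,
      ← (Fin.snocEquiv fun _ => Bool).sum_comp, Fintype.sum_prod_type]
    refine Finset.sum_congr rfl fun b _ => ?_
    rw [map_sum, Finset.smul_sum]
    refine Finset.sum_congr rfl fun s _ => ?_
    simp only [Fin.snocEquiv_apply, Fin.foldl_succ_last, Fin.prod_univ_castSucc, Fin.snoc_castSucc,
      Fin.snoc_last, map_smul, smul_smul, mul_comm]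

lemma cavityState_eq_iterate_mixedMap {ε : ℝ} (hε : 0 < ε) (E g τ : ℝ) {r : Matrix Bool Bool ℂ}
    (hr : IsAtomState r) (ρ : Op ℕ) (n : ℕ) :
    cavityState ε E g τ r ρ n = (mixedMap ε g τ r)^[n] ρ := by
  rw [cavityState_eq_sum hε E g τ hr, sum_foldl_eq_iterate]

lemma stepMap_eq {ε : ℝ} (hε : 0 < ε) (E g τ : ℝ) {r : Matrix Bool Bool ℂ}
    (hr : IsAtomState r) : stepMap ε E g τ r = mixedMap ε g τ r := by
  ext1 ρ
  have h := cavityState_eq_iterate_mixedMap hε E g τ hr ρ 1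
  simpa [cavityState, jointState, Fin.foldl_succ, stepMap] using h

/-! ### Photon numbers of displaced number states -/

/-- Unitary operators that act on the exponential vectors, up to factors, by `z ↦ u z + α`. -/
structure IsDisplacement (u α : ℂ) (T : Op ℕ) : Prop where
  unitary : T ∈ unitary (Op ℕ)
  expVec : ∀ z, ∃ c : ℂ, T (expVec z) = c • PhotonCavity.expVec (u * z + α)

lemma IsDisplacement.one : IsDisplacement 1 0 1 :=
  ⟨one_mem _, fun z => ⟨1, by simp⟩⟩

lemma IsDisplacement.mul {u α u' α' : ℂ} {T T' : Op ℕ} (hT : IsDisplacement u α T)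
    (hT' : IsDisplacement u' α' T') : IsDisplacement (u * u') (u * α' + α) (T * T') := by
  refine ⟨mul_mem hT.unitary hT'.unitary, fun z => ?_⟩
  obtain ⟨c', h'⟩ := hT'.expVec z
  obtain ⟨c, h⟩ := hT.expVec (u' * z + α')
  refine ⟨c' * c, ?_⟩
  rw [mul_apply_eq_comp, h', map_smul, h, smul_smul]
  congr 2
  ring

lemma isDisplacement_oscGroup (ε β t : ℝ) :
    IsDisplacement (rot ε t) (β * (rot ε t - 1)) (oscGroup ε β t) := by
  refine ⟨oscGroup_mem_unitary ε β t, fun z => ⟨Complex.exp (oscExponent ε β t z), ?_⟩⟩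
  rw [oscGroup_expVec]
  congr 2
  rw [oscFlow]; ring

lemma hasSum_expVec (z : ℂ) : HasSum
    (fun j : ℕ => (z ^ j / (Real.sqrt j.factorial : ℂ)) • numberState j) (expVec z) := by
  have h := lp.hasSum_single (p := 2) (by simp) (expVec z)
  refine h.congr_fun fun j => ?_
  rw [numberState, ← lp.single_smul, smul_eq_mul, mul_one, expVec_apply]

lemma inner_numberState_left (j : ℕ) (v : Cavity) : ⟪numberState j, v⟫_ℂ = v j := by
  rw [numberState, lp.inner_single_left]; simp

lemma norm_numberState (j : ℕ) : ‖numberState j‖ = 1 := by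
  rw [numberState, lp.norm_single (by simp), norm_one]

/-- These are the matrix elements of `b T = T (u b + α)`. They come from comparing power series in
`z`: passing from amplitude `m` to `m + 1` of the image of `expVec z` multiplies by `(u z + α) / √(m
+ 1)`, whatever the prefactor `c` is. -/
lemma IsDisplacement.sqrt_mul_apply {u α : ℂ} {T : Op ℕ} (hT : IsDisplacement u α T) (m j : ℕ) :
    (Real.sqrt (m + 1) : ℂ) * T (numberState j) (m + 1)
      = u * (Real.sqrt j * T (numberState (j - 1)) m) + α * T (numberState j) m := by
  set f : ℕ → ℕ → ℂ := fun m j => T (numberState j) m with hf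
  have hgrowth : ∀ m, ExpGrowth (f m) := fun m => .of_bounded 1 fun j => by
    refine (lp.norm_apply_le_norm (by simp) (T (numberState j)) m).trans ?_
    rw [ContinuousLinearMap.norm_map_of_mem_unitary hT.unitary, norm_numberState]
  have hser : ∀ m z, T (PhotonCavity.expVec z) m = fockSeries (f m) z := by
    intro m z
    have h1 := (T.hasSum (hasSum_expVec z)).map
      (lp.evalCLM ℂ (fun _ : ℕ => ℂ) 2 m) (ContinuousLinearMap.continuous _)
    rw [fockSeries]
    refine (h1.tsum_eq.symm).trans (tsum_congr fun j => ?_)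
    change (T ((z ^ j / (Real.sqrt j.factorial : ℂ)) • numberState j)) m = _
    rw [map_smul, lp.coeFn_smul, Pi.smul_apply, smul_eq_mul, mul_comm]
  have hkey : ((Real.sqrt (m + 1) : ℂ)) • f (m + 1) = u • create (f m) + α • f m := by
    refine fockSeries_injective ((hgrowth _).smul _)
      (((hgrowth m).create.smul u).add ((hgrowth m).smul α)) fun z => ?_
    rw [fockSeries_smul, fockSeries_add ((hgrowth m).create.smul u) ((hgrowth m).smul α),
      fockSeries_smul, fockSeries_smul, fockSeries_create (hgrowth m), ← hser, ← hser]
    obtain ⟨c, hc⟩ := hT.expVec z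
    rw [hc]
    simp only [lp.coeFn_smul, Pi.smul_apply, smul_eq_mul, expVec_apply, sqrt_factorial_succ]
    have h1 := sqrt_succ_ne_zero m
    have h2 := sqrt_factorial_ne_zero m
    field_simp
    ring
  exact congrFun hkey j

/-- The sum is `‖b T e_j‖² = ‖(u b + α) e_j‖²`, and `b e_j` is orthogonal to `e_j`. For `j = 0` the
truncated index `j - 1` is harmless because its coefficient `√0` vanishes. -/
lemma IsDisplacement.tsum_photons {u α : ℂ} {T : Op ℕ} (hT : IsDisplacement u α T) (hu : ‖u‖ = 1)
    (j : ℕ) : ∑' m : ℕ, ENNReal.ofReal (m * ‖T (numberState j) m‖ ^ 2)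
      = ENNReal.ofReal (j + ‖α‖ ^ 2) := by
  rw [tsum_eq_zero_add' ENNReal.summable]
  simp only [Nat.cast_zero, zero_mul, ENNReal.ofReal_zero, zero_add]
  set v : Cavity := T ((u * Real.sqrt j) • numberState (j - 1) + α • numberState j) with hv
  have h1 : ∀ m : ℕ, (((m + 1 : ℕ) : ℝ)) * ‖T (numberState j) (m + 1)‖ ^ 2 = ‖v m‖ ^ 2 := by
    intro m
    have h2 := hT.sqrt_mul_apply m j
    have h3 : v m = u * (Real.sqrt j * T (numberState (j - 1)) m) + α * T (numberState j) m := by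
      rw [hv, map_add, map_smul, map_smul]
      simp only [lp.coeFn_add, lp.coeFn_smul, Pi.add_apply, Pi.smul_apply, smul_eq_mul]
      ring
    rw [h3, ← h2, norm_mul, mul_pow, Complex.norm_real, Real.norm_eq_abs, sq_abs,
      Real.sq_sqrt (by positivity)]
    push_cast
    rfl
  simp only [h1]
  rw [← ENNReal.ofReal_tsum_of_nonneg (fun _ => by positivity)
    (memℓp_two_iff.1 (lp.memℓp v)), ← norm_sq_eq_tsum, hv,
    ContinuousLinearMap.norm_map_of_mem_unitary hT.unitary]
  congr 1
  have horth : ⟪((u * Real.sqrt j) • numberState (j - 1) : Cavity), α • numberState j⟫_ℂ = 0 := by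
    rcases j with _ | j
    · simp
    · rw [inner_smul_left, inner_smul_right, numberState, lp.inner_single_left]
      simp [numberState]
  rw [sq, norm_add_sq_eq_norm_sq_add_norm_sq_of_inner_eq_zero _ _ horth, ← sq, ← sq, norm_smul,
    norm_smul, norm_numberState, norm_numberState, norm_mul, hu, Complex.norm_real,
    Real.norm_eq_abs, mul_one, mul_one, one_mul, sq_abs, Real.sq_sqrt (by positivity)]

/-! ### Gauge-invariant states -/

lemma oscGroup_numberState (t : ℝ) (m : ℕ) :
    oscGroup 1 0 t (numberState m) = rot 1 t ^ m • numberState m := by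
  refine lp.ext (fockSeries_injective (expGrowth_coe _) (expGrowth_coe _) fun z => ?_)
  have h : ∀ w, fockSeries (numberState m) w = w ^ m / (Real.sqrt m.factorial : ℂ) := by
    intro w
    rw [fockSeries, tsum_eq_single m]
    · simp [numberState]
    · intro k hk; simp [numberState, hk]
  rw [fockSeries_oscGroup, lp.coeFn_smul, fockSeries_smul, h, h]
  simp [oscExponent, oscFlow, mul_pow, mul_div_assoc]

/-- A gauge rotation by the angle `π / (j - i)` multiplies this matrix element by `-1`. -/
lemma IsGaugeInvariant.inner_eq_zero {ρ : Op ℕ} (h : IsGaugeInvariant ρ) {i j : ℕ} (hij : i ≠ j) :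
    ⟪numberState i, ρ (numberState j)⟫_ℂ = 0 := by
  have hne : (j : ℝ) - i ≠ 0 := sub_ne_zero.2 (by exact_mod_cast hij.symm)
  set t : ℝ := Real.pi / (j - i) with ht
  have h1 := h t
  rw [propagator_numberOp, propagator_numberOp] at h1
  have h2 : ⟪numberState i, ρ (numberState j)⟫_ℂ
      = (rot 1 (-t) ^ i * rot 1 t ^ j) * ⟪numberState i, ρ (numberState j)⟫_ℂ := by
    conv_lhs => rw [← h1]
    rw [mul_apply_eq_comp, mul_apply_eq_comp, inner_oscGroup, neg_neg, oscGroup_numberState,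
      oscGroup_numberState, map_smul, inner_smul_left, inner_smul_right, map_pow, conj_rot]
    ring
  have h3 : rot 1 (-t) ^ i * rot 1 t ^ j = -1 := by
    rw [rot, rot, ← Complex.exp_nat_mul, ← Complex.exp_nat_mul, ← Complex.exp_add]
    have : (i : ℂ) * -(Complex.I * (1 : ℝ) * ((-t : ℝ) : ℂ)) + j * -(Complex.I * (1 : ℝ) * (t : ℂ))
        = -(Real.pi * Complex.I) := by
      have e : t * (j - i) = Real.pi := by rw [ht]; field_simp
      rw [← e]
      push_cast
      ring
    rw [this, Complex.exp_neg, Complex.exp_pi_mul_I]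
    norm_num
  rw [h3] at h2
  linear_combination (1 / 2 : ℂ) * h2

/-- The population of the `j`-photon state. -/
def population (ρ : Op ℕ) (j : ℕ) : ℝ := (⟪numberState j, ρ (numberState j)⟫_ℂ).re

lemma IsDensityOp.population_nonneg {ρ : Op ℕ} (hρ : IsDensityOp ρ) (j : ℕ) :
    0 ≤ population ρ j :=
  hρ.pos.re_inner_nonneg_right _

lemma IsDensityOp.hasSum_population {ρ : Op ℕ} (hρ : IsDensityOp ρ) : HasSum (population ρ) 1 :=
  Complex.hasSum_re hρ.trace_one

lemma IsDensityOp.inner_numberState {ρ : Op ℕ} (hρ : IsDensityOp ρ) (j : ℕ) :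
    ⟪numberState j, ρ (numberState j)⟫_ℂ = population ρ j := by
  have h := hρ.pos.inner_nonneg_right (numberState j)
  exact (Complex.eq_re_of_ofReal_le (r := 0) (by simpa using h))

lemma IsDensityOp.apply_numberState {ρ : Op ℕ} (hρ : IsDensityOp ρ) (hg : IsGaugeInvariant ρ)
    (j : ℕ) : ρ (numberState j) = (population ρ j : ℂ) • numberState j := by
  ext i
  have h1 : ρ (numberState j) i = ⟪numberState i, ρ (numberState j)⟫_ℂ := by
    rw [inner_numberState_left]
  rw [h1, lp.coeFn_smul, Pi.smul_apply]
  by_cases h : i = j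
  · subst h
    rw [hρ.inner_numberState]
    simp [numberState]
  · rw [hg.inner_eq_zero h]
    simp [numberState, h]

lemma IsDensityOp.hasSum_inner {ρ : Op ℕ} (hρ : IsDensityOp ρ) (hg : IsGaugeInvariant ρ)
    (v : Cavity) : HasSum (fun j => population ρ j * ‖v j‖ ^ 2) (⟪v, ρ v⟫_ℂ).re := by
  have h1 : ∀ j, (ρ v) j = population ρ j * v j := by
    intro j
    have h2 : ⟪ρ (numberState j), v⟫_ℂ = ⟪numberState j, ρ v⟫_ℂ :=
      hρ.pos.isSymmetric (numberState j) v
    rw [← inner_numberState_left, ← h2, hρ.apply_numberState hg, inner_smul_left,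
      Complex.conj_ofReal, inner_numberState_left]
  have h3 := Complex.hasSum_re (lp.hasSum_inner v (ρ v))
  refine h3.congr_fun fun j => ?_
  rw [h1]
  change (_ : ℝ) = (population ρ j * v j * conj (v j)).re
  rw [mul_assoc, Complex.mul_conj, ← Complex.ofReal_mul, Complex.ofReal_re,
    Complex.normSq_eq_norm_sq]

/-! ### Photon number of mixtures of displaced states -/

lemma inner_conj_apply (T ρ : Op ℕ) (m : ℕ) :
    ⟪numberState m, (T * ρ * star T) (numberState m)⟫_ℂ
      = ⟪star T (numberState m), ρ (star T (numberState m))⟫_ℂ := by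
  rw [mul_apply_eq_comp, mul_apply_eq_comp, ContinuousLinearMap.star_eq_adjoint,
    ContinuousLinearMap.adjoint_inner_left]

lemma norm_star_numberState_apply (T : Op ℕ) (m j : ℕ) :
    ‖star T (numberState m) j‖ = ‖T (numberState j) m‖ := by
  rw [← inner_numberState_left, ← inner_numberState_left, ContinuousLinearMap.star_eq_adjoint,
    ContinuousLinearMap.adjoint_inner_right, norm_inner_symm]

/-- Diagonality of `ρ` reduces the count to number states weighted by populations. The sums are
exchanged in `[0, ∞]`, so an infinite initial photon number is covered. -/
lemma photonNumber_displacement {ρ : Op ℕ} (hρ : IsDensityOp ρ) (hg : IsGaugeInvariant ρ)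
    {u α : ℂ} {T : Op ℕ} (hT : IsDisplacement u α T) (hu : ‖u‖ = 1) :
    photonNumber (T * ρ * star T) = photonNumber ρ + ENNReal.ofReal (‖α‖ ^ 2) := by
  have h1 : ∀ m : ℕ,
      ENNReal.ofReal (m * (⟪numberState m, (T * ρ * star T) (numberState m)⟫_ℂ).re)
        = ∑' j, ENNReal.ofReal (population ρ j)
            * ENNReal.ofReal (m * ‖T (numberState j) m‖ ^ 2) := by
    intro m
    have h2 := (hρ.hasSum_inner hg (star T (numberState m))).mul_left (m : ℝ)
    rw [inner_conj_apply, ← h2.tsum_eq, ENNReal.ofReal_tsum_of_nonneg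
      (fun j => mul_nonneg m.cast_nonneg (mul_nonneg (hρ.population_nonneg j) (by positivity)))
      h2.summable]
    refine tsum_congr fun j => ?_
    rw [norm_star_numberState_apply, ← ENNReal.ofReal_mul (hρ.population_nonneg j)]
    ring_nf
  have h3 : ∑' j, ENNReal.ofReal (population ρ j) = 1 := by
    rw [← ENNReal.ofReal_tsum_of_nonneg hρ.population_nonneg hρ.hasSum_population.summable,
      hρ.hasSum_population.tsum_eq, ENNReal.ofReal_one]
  rw [photonNumber, tsum_congr h1, ENNReal.tsum_comm]
  simp only [ENNReal.tsum_mul_left, hT.tsum_photons hu]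
  have h4 : ∀ j : ℕ, ENNReal.ofReal (population ρ j) * ENNReal.ofReal (j + ‖α‖ ^ 2)
      = ENNReal.ofReal (j * population ρ j)
        + ENNReal.ofReal (population ρ j) * ENNReal.ofReal (‖α‖ ^ 2) := by
    intro j
    rw [ENNReal.ofReal_add (by positivity) (by positivity), mul_add, mul_comm (j : ℝ),
      ENNReal.ofReal_mul (hρ.population_nonneg j)]
  rw [tsum_congr h4, ENNReal.tsum_add, ENNReal.tsum_mul_right, h3, one_mul]
  rfl

lemma photonNumber_sum_smul {ι : Type} [Fintype ι] {w : ι → ℝ} (hw : ∀ i, 0 ≤ w i) (X : ι → Op ℕ)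
    (hX : ∀ i m, 0 ≤ (⟪numberState m, X i (numberState m)⟫_ℂ).re) :
    photonNumber (∑ i, (w i : ℂ) • X i) = ∑ i, ENNReal.ofReal (w i) * photonNumber (X i) := by
  simp only [photonNumber, ← ENNReal.tsum_mul_left]
  rw [← Summable.tsum_finsetSum fun _ _ => ENNReal.summable]
  refine tsum_congr fun m => ?_
  have h : (⟪numberState m, (∑ i, (w i : ℂ) • X i) (numberState m)⟫_ℂ).re
      = ∑ i, w i * (⟪numberState m, X i (numberState m)⟫_ℂ).re := by
    rw [sum_apply, inner_sum, Complex.re_sum]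
    refine Finset.sum_congr rfl fun i _ => ?_
    rw [smul_apply, inner_smul_right, Complex.re_ofReal_mul]
  rw [h, Finset.mul_sum, ENNReal.ofReal_sum_of_nonneg
    fun i _ => mul_nonneg m.cast_nonneg (mul_nonneg (hw i) (hX i m))]
  refine Finset.sum_congr rfl fun i _ => ?_
  rw [← ENNReal.ofReal_mul (hw i)]
  ring_nf

lemma photonNumber_mixture {ρ : Op ℕ} (hρ : IsDensityOp ρ) (hg : IsGaugeInvariant ρ)
    {ι : Type} [Fintype ι] {w : ι → ℝ} (hw : ∀ i, 0 ≤ w i) (hw1 : ∑ i, w i = 1)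
    {u : ℂ} (hu : ‖u‖ = 1) {α : ι → ℂ} {Z : ι → Op ℕ} (hZ : ∀ i, IsDisplacement u (α i) (Z i)) :
    photonNumber (∑ i, (w i : ℂ) • (Z i * ρ * star (Z i)))
      = photonNumber ρ + ENNReal.ofReal (∑ i, w i * ‖α i‖ ^ 2) := by
  rw [photonNumber_sum_smul hw _ fun i m => by
    rw [inner_conj_apply]; exact hρ.pos.re_inner_nonneg_right _]
  simp only [fun i => photonNumber_displacement hρ hg (hZ i) hu, mul_add, Finset.sum_add_distrib]
  rw [← Finset.sum_mul, ← ENNReal.ofReal_sum_of_nonneg fun i _ => hw i, hw1, ENNReal.ofReal_one,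
    one_mul, ENNReal.ofReal_sum_of_nonneg fun i _ => mul_nonneg (hw i) (by positivity)]
  congr 1
  exact Finset.sum_congr rfl fun i _ => (ENNReal.ofReal_mul (hw i)).symm

/-! ### Random displacements along the beam -/

lemma re_rot (ε t : ℝ) : (rot ε t).re = Real.cos (ε * t) := by
  rw [rot, show -(Complex.I * ε * t) = ((-(ε * t) : ℝ) : ℂ) * Complex.I by push_cast; ring,
    Complex.exp_ofReal_mul_I_re, Real.cos_neg]

lemma rot_pow (ε t : ℝ) (n : ℕ) : rot ε t ^ n = rot ε (n * t) := by
  rw [rot, rot, ← Complex.exp_nat_mul]; push_cast; ring_nf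

/-- The mean number of photons gained during the passage of `n` atoms that are excited with
probability `p`. -/
def photonGain (ε g τ p : ℝ) (n : ℕ) : ℝ :=
  n * (p * (1 - p)) * (2 * g ^ 2 / ε ^ 2) * (1 - Real.cos (ε * τ))
    + p ^ 2 * (2 * g ^ 2 / ε ^ 2) * (1 - Real.cos (n * ε * τ))

lemma norm_sq_rot_mul_add (ε τ β : ℝ) (α : ℂ) :
    ‖rot ε τ * α + β * (rot ε τ - 1)‖ ^ 2
      = ‖α‖ ^ 2 + 2 * β * ((1 - rot ε τ) * α).re + 2 * β ^ 2 * (1 - Real.cos (ε * τ)) := by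
  have h := rot_neg_mul ε τ
  rw [← conj_rot] at h
  have hr := congrArg Complex.re h
  rw [← re_rot, ← Complex.normSq_eq_norm_sq, ← Complex.normSq_eq_norm_sq]
  simp only [Complex.normSq_apply, Complex.add_re, Complex.add_im, Complex.mul_re, Complex.mul_im,
    Complex.sub_re, Complex.sub_im, Complex.ofReal_re, Complex.ofReal_im, Complex.one_re,
    Complex.one_im, Complex.conj_re, Complex.conj_im] at hr ⊢
  linear_combination (α.re ^ 2 + α.im ^ 2 + 2 * β * α.re + β ^ 2) * hr

/-- The mean of `α` is carried along because the recursion for the second moment is closed only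
together with the first. The common factor `rot ε τ ^ n` does not depend on the levels. -/
lemma exists_mixture (ε g τ p : ℝ) (hp0 : 0 ≤ p) (hp1 : p ≤ 1) {r : Matrix Bool Bool ℂ}
    (ht : r true true = p) (hf : r false false = ((1 - p : ℝ) : ℂ)) (ρ : Op ℕ) (n : ℕ) :
    ∃ (ι : Type) (_ : Fintype ι) (w : ι → ℝ) (α : ι → ℂ) (Z : ι → Op ℕ),
      (∀ i, 0 ≤ w i) ∧ ∑ i, w i = 1 ∧ (∀ i, IsDisplacement (rot ε τ ^ n) (α i) (Z i)) ∧
      (mixedMap ε g τ r)^[n] ρ = ∑ i, (w i : ℂ) • (Z i * ρ * star (Z i)) ∧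
      ∑ i, (w i : ℂ) * α i = p * (g / ε : ℝ) * (rot ε τ ^ n - 1) ∧
      ∑ i, w i * ‖α i‖ ^ 2 = photonGain ε g τ p n := by
  induction n with
  | zero =>
    refine ⟨Unit, inferInstance, fun _ => 1, fun _ => 0, fun _ => 1, ?_, ?_, ?_, ?_, ?_, ?_⟩
    · simp
    · simp
    · simpa using IsDisplacement.one
    · simp
    · simp
    · simp [photonGain]
  | succ n ih =>
    obtain ⟨ι, hι, w, α, Z, hw, hw1, hZ, hstate, hm1, hm2⟩ := ih
    set u := rot ε τ with hu
    set q : Bool → ℝ := fun b => if b then p else 1 - p with hq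
    have hqr : ∀ b, r b b = (q b : ℂ) := by
      intro b; cases b
      · simpa [hq] using hf
      · simpa [hq] using ht
    refine ⟨ι × Bool, inferInstance, fun x => w x.1 * q x.2,
      fun x => u * α x.1 + coupling ε g x.2 * (u - 1),
      fun x => oscGroup ε (coupling ε g x.2) τ * Z x.1, ?_, ?_, ?_, ?_, ?_, ?_⟩
    · rintro ⟨i, b⟩
      refine mul_nonneg (hw i) ?_
      cases b <;> simp [hq, hp0, hp1]
    · simp [Fintype.sum_prod_type, hq, ← mul_add, hw1]
    · rintro ⟨i, b⟩
      rw [pow_succ']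
      exact (isDisplacement_oscGroup ε _ τ).mul (hZ i)
    · rw [Function.iterate_succ_apply', hstate, mixedMap_apply, Fintype.sum_prod_type_right]
      refine Finset.sum_congr rfl fun b _ => ?_
      rw [map_sum, Finset.smul_sum]
      refine Finset.sum_congr rfl fun i _ => ?_
      rw [map_smul, levelMap_apply, smul_smul, hqr, star_mul]
      push_cast
      rw [mul_comm]
      simp only [mul_assoc]
    · have h1 : ∀ i, ∑ b, ((w i * q b : ℝ) : ℂ) * (u * α i + coupling ε g b * (u - 1))
          = u * (w i * α i) + (w i : ℂ) * (p * (g / ε : ℝ) * (u - 1)) := by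
        intro i
        simp only [Fintype.sum_bool, hq, coupling]
        push_cast
        simp
        ring
      rw [Fintype.sum_prod_type]
      simp only [h1]
      rw [Finset.sum_add_distrib, ← Finset.mul_sum, hm1, ← Finset.sum_mul, ← Complex.ofReal_sum,
        hw1]
      push_cast
      ring
    · have h1 : ∀ i, ∑ b, w i * q b * ‖u * α i + coupling ε g b * (u - 1)‖ ^ 2
          = w i * ‖α i‖ ^ 2 + 2 * p * (g / ε) * ((1 - u) * (w i * α i)).re
            + w i * (p * (2 * (g / ε) ^ 2 * (1 - Real.cos (ε * τ)))) := by
        intro i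
        simp only [hu, norm_sq_rot_mul_add]
        have h2 : ((1 - rot ε τ) * (w i * α i)).re = w i * ((1 - rot ε τ) * α i).re := by
          rw [mul_left_comm, Complex.re_ofReal_mul]
        rw [h2]
        simp [hq, coupling]
        ring
      rw [Fintype.sum_prod_type]
      simp only [h1]
      rw [Finset.sum_add_distrib, Finset.sum_add_distrib, hm2, ← Finset.mul_sum, ← Complex.re_sum,
        ← Finset.mul_sum, hm1, ← Finset.sum_mul, hw1]
      -- The cross term contributes the increment of the oscillating part and turns the factor `p`
      -- of the constant term into `p (1 - p)`.
      have h3 : ((1 - u) * (p * (g / ε : ℝ) * (u ^ n - 1))).re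
          = p * (g / ε) * (Real.cos (n * ε * τ) - 1 - Real.cos ((n + 1 : ℕ) * ε * τ)
            + Real.cos (ε * τ)) := by
        have h4 : (1 - u) * (p * (g / ε : ℝ) * (u ^ n - 1))
            = ((p * (g / ε) : ℝ) : ℂ) * (u ^ n - 1 - u ^ (n + 1) + u) := by
          push_cast; ring
        rw [h4, Complex.re_ofReal_mul, hu, rot_pow, rot_pow]
        simp only [Complex.add_re, Complex.sub_re, Complex.one_re, re_rot]
        ring_nf
      rw [h3, photonGain, photonGain]
      push_cast
      ring

/-! ### The mean photon number -/

lemma excitation_eq (r : Matrix Bool Bool ℂ) : excitation r = (r true true).re := by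
  rw [excitation, lowering_conjTranspose_mul]
  simp [Matrix.trace, Matrix.mul_apply, Matrix.single_apply]

lemma IsAtomState.apply_true {r : Matrix Bool Bool ℂ} (hr : IsAtomState r) :
    r true true = (excitation r : ℂ) := by
  rw [excitation_eq]
  exact Complex.eq_re_of_ofReal_le (r := 0) (by simpa using hr.pos.diag_nonneg)

lemma IsAtomState.apply_false {r : Matrix Bool Bool ℂ} (hr : IsAtomState r) :
    r false false = ((1 - excitation r : ℝ) : ℂ) := by
  have h := hr.trace_one
  rw [Matrix.trace, Fintype.sum_bool, Matrix.diag_apply, Matrix.diag_apply, hr.apply_true] at h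
  push_cast
  rw [← h]; ring

lemma IsAtomState.excitation_nonneg {r : Matrix Bool Bool ℂ} (hr : IsAtomState r) :
    0 ≤ excitation r := by
  have h : 0 ≤ r true true := hr.pos.diag_nonneg
  rw [hr.apply_true] at h
  exact_mod_cast h

lemma IsAtomState.excitation_le_one {r : Matrix Bool Bool ℂ} (hr : IsAtomState r) :
    excitation r ≤ 1 := by
  have h : 0 ≤ r false false := hr.pos.diag_nonneg
  rw [hr.apply_false] at h
  have : 0 ≤ 1 - excitation r := by exact_mod_cast h
  linarith

lemma photonNumber_cavityState {ε : ℝ} (hε : 0 < ε) (E g τ : ℝ) {r : Matrix Bool Bool ℂ}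
    (hr : IsAtomState r) {ρ : Op ℕ} (hρ : IsDensityOp ρ) (hgauge : IsGaugeInvariant ρ) (n : ℕ) :
    photonNumber (cavityState ε E g τ r ρ n)
      = photonNumber ρ + ENNReal.ofReal (photonGain ε g τ (excitation r) n) := by
  obtain ⟨ι, _, w, α, Z, hw, hw1, hZ, hstate, -, hm2⟩ := exists_mixture ε g τ (excitation r)
    hr.excitation_nonneg hr.excitation_le_one hr.apply_true hr.apply_false ρ n
  rw [cavityState_eq_iterate_mixedMap hε E g τ hr, hstate,
    photonNumber_mixture hρ hgauge hw hw1 (by rw [norm_pow, norm_rot, one_pow]) hZ, hm2]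

lemma photonGain_eq (ε g τ p : ℝ) (n : ℕ) :
    photonGain ε g τ p n = p * (1 - p) * (2 * g ^ 2 / ε ^ 2) * (1 - Real.cos (ε * τ)) * n
      + p ^ 2 * (2 * g ^ 2 / ε ^ 2) * (1 - Real.cos (n * ε * τ)) := by
  rw [photonGain]; ring

lemma oscillation_mem_Icc (ε g τ p : ℝ) (hp0 : 0 ≤ p) (hp1 : p ≤ 1) (n : ℕ) :
    p ^ 2 * (2 * g ^ 2 / ε ^ 2) * (1 - Real.cos (n * ε * τ))
      ∈ Set.Icc 0 (2 * (2 * g ^ 2 / ε ^ 2)) := by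
  have h1 := Real.cos_le_one (n * ε * τ)
  have h2 := Real.neg_one_le_cos (n * ε * τ)
  have hκ : 0 ≤ 2 * g ^ 2 / ε ^ 2 := by positivity
  refine ⟨mul_nonneg (by positivity) (by linarith), ?_⟩
  calc p ^ 2 * (2 * g ^ 2 / ε ^ 2) * (1 - Real.cos (n * ε * τ))
      ≤ 1 * (2 * g ^ 2 / ε ^ 2) * 2 := by
        gcongr
        · exact pow_le_one₀ hp0 hp1
        · linarith
    _ = _ := by ring

/-- Boundedness and growth of a sequence that is linear up to a bounded nonnegative term. -/
lemma linear_growth_tfae {N₀ : ℝ≥0∞} (hN₀ : N₀ ≠ ⊤) {N : ℕ → ℝ≥0∞} {F B : ℕ → ℝ} {c K : ℝ}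
    (hc : 0 ≤ c) (hB : ∀ n, B n ∈ Set.Icc 0 K) (hF : ∀ n, F n = c * n + B n)
    (hN : ∀ n, N n = N₀ + ENNReal.ofReal (F n)) :
    (∀ n, N n ≠ ⊤) ∧
      (0 < c ↔ ∃ c : ℝ, 0 < c ∧ ∃ C : ℝ, ∀ n : ℕ, |(N n).toReal - c * n| ≤ C) ∧
      (0 < c ↔ Filter.Tendsto N Filter.atTop (nhds ⊤)) ∧
      (¬ 0 < c ↔ ∃ C : NNReal, ∀ n, N n ≤ C) := by
  have hF0 : ∀ n, 0 ≤ F n := fun n => by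
    rw [hF]; exact add_nonneg (by positivity) (hB n).1
  have hr : ∀ n, (N n).toReal = N₀.toReal + F n := fun n => by
    rw [hN, ENNReal.toReal_add hN₀ ENNReal.ofReal_ne_top, ENNReal.toReal_ofReal (hF0 n)]
  have hbdd : ¬ 0 < c → ∃ C : NNReal, ∀ n, N n ≤ C := by
    intro h
    obtain rfl : c = 0 := le_antisymm (not_lt.1 h) hc
    refine ⟨(N₀ + ENNReal.ofReal K).toNNReal, fun n => ?_⟩
    rw [ENNReal.coe_toNNReal (by simp [hN₀]), hN, hF, zero_mul, zero_add]
    gcongr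
    exact (hB n).2
  have htend : 0 < c → Filter.Tendsto N Filter.atTop (nhds ⊤) := by
    intro h
    have h1 : Filter.Tendsto (fun n : ℕ => ENNReal.ofReal (c * n)) Filter.atTop (nhds ⊤) :=
      ENNReal.tendsto_ofReal_atTop.comp (tendsto_natCast_atTop_atTop.const_mul_atTop h)
    refine tendsto_nhds_top_mono' h1 fun n => ?_
    rw [hN, hF]
    exact le_add_left (ENNReal.ofReal_le_ofReal (by linarith [(hB n).1]))
  have hnot : Filter.Tendsto N Filter.atTop (nhds ⊤) → ¬ ∃ C : NNReal, ∀ n, N n ≤ C := by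
    rintro h ⟨C, hC⟩
    obtain ⟨n, hn⟩ := (h.eventually (lt_mem_nhds (ENNReal.coe_lt_top (r := C)))).exists
    exact absurd (hC n) (not_le.2 hn)
  refine ⟨fun n => by simp [hN, hN₀], ⟨fun h => ?_, ?_⟩, ⟨htend, fun h => ?_⟩, hbdd, fun h h' => ?_⟩
  · refine ⟨c, h, N₀.toReal + K, fun n => ?_⟩
    rw [hr, hF, abs_le]
    have := (hB n).1
    have := (hB n).2
    have : 0 ≤ N₀.toReal := ENNReal.toReal_nonneg
    constructor <;> linarith
  · rintro ⟨c', hc', C, hC⟩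
    by_contra h
    obtain ⟨D, hD⟩ := hbdd h
    obtain ⟨n, hn⟩ := exists_nat_gt ((C + D) / c')
    rw [div_lt_iff₀ hc'] at hn
    have h1 := (abs_le.1 (hC n)).1
    have h2 : (N n).toReal ≤ D := ENNReal.toReal_mono ENNReal.coe_ne_top (hD n)
    linarith
  · by_contra h'
    exact hnot h (hbdd h')
  · exact hnot (htend h') h

end

end PhotonCavity

theorem theorem4p2p1
    (ε E g τ : ℝ) (hε : 0 < ε) (hτ : 0 < τ)
    (r : Matrix Bool Bool ℂ) (hr : IsAtomState r)
    (ρ : Op ℕ) (hρ : IsDensityOp ρ) (hgauge : IsGaugeInvariant ρ)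
    (p : ℝ) (hp : p = excitation r)
    (N : ℕ → ENNReal) (hN : ∀ n, N n = photonNumber (cavityState ε E g τ r ρ n)) :
    -- the cavity state at time `nτ` is the `n`-fold iterate of the one-step map
    (∀ n : ℕ, cavityState ε E g τ r ρ n = (stepMap ε E g τ r)^[n] ρ) ∧
    -- the mean photon number at time `nτ`
    N 0 = photonNumber ρ ∧
    (∀ n : ℕ, N n = N 0 + ENNReal.ofReal
      (n * (p * (1 - p)) * (2 * g ^ 2 / ε ^ 2) * (1 - Real.cos (ε * τ))
        + p ^ 2 * (2 * g ^ 2 / ε ^ 2) * (1 - Real.cos (n * ε * τ)))) ∧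
    -- unbounded pumping exactly for `0 < p < 1`
    (N 0 ≠ ⊤ → g ≠ 0 → Real.cos (ε * τ) ≠ 1 →
      (∀ n, N n ≠ ⊤) ∧
      ((0 < p ∧ p < 1) ↔
        ∃ c : ℝ, 0 < c ∧ ∃ C : ℝ, ∀ n : ℕ, |(N n).toReal - c * n| ≤ C) ∧
      ((0 < p ∧ p < 1) ↔ Filter.Tendsto N Filter.atTop (nhds ⊤)) ∧
      (¬ (0 < p ∧ p < 1) ↔ ∃ C : NNReal, ∀ n, N n ≤ C)) := by
  have hp0 : 0 ≤ p := hp ▸ hr.excitation_nonneg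
  have hp1 : p ≤ 1 := hp ▸ hr.excitation_le_one
  have hN' : ∀ n, N n = photonNumber ρ + ENNReal.ofReal (photonGain ε g τ p n) := fun n => by
    rw [hN, hp, photonNumber_cavityState hε E g τ hr hρ hgauge]
  have hN0 : N 0 = photonNumber ρ := by rw [hN' 0]; simp [photonGain]
  refine ⟨fun n => ?_, hN0, fun n => ?_, fun hfin hg hcos => ?_⟩
  · rw [cavityState_eq_iterate_mixedMap hε E g τ hr, stepMap_eq hε E g τ hr]
  · rw [hN', hN0, photonGain]
  · have hκ : 0 < 2 * g ^ 2 / ε ^ 2 := by positivity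
    have hcos' : 0 < 1 - Real.cos (ε * τ) :=
      sub_pos.2 (lt_of_le_of_ne (Real.cos_le_one _) hcos)
    -- The right side is the slope of the linear part of the gain; its other factors are positive,
    -- since the coupling is nonzero and `ετ` is off resonance.
    have hiff : (0 < p ∧ p < 1)
        ↔ 0 < p * (1 - p) * (2 * g ^ 2 / ε ^ 2) * (1 - Real.cos (ε * τ)) := by
      rw [mul_pos_iff_of_pos_right hcos', mul_pos_iff_of_pos_right hκ]
      refine ⟨fun h => mul_pos h.1 (sub_pos.2 h.2), fun h => ⟨?_, ?_⟩⟩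
      · exact lt_of_le_of_ne hp0 fun h0 => by simp [← h0] at h
      · exact lt_of_le_of_ne hp1 fun h1 => by simp [h1] at h
    rw [hiff]
    exact linear_growth_tfae (hN0 ▸ hfin) (mul_nonneg (mul_nonneg
        (mul_nonneg hp0 (sub_nonneg.2 hp1)) hκ.le) hcos'.le)
      (oscillation_mem_Icc ε g τ p hp0 hp1) (photonGain_eq ε g τ p) hN'
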